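/- Let $M$ be a smooth (Hausdorff, finite-dimensional, not necessarily connected) manifold, $\mathfrak X(M)=\Gamma(TM)$ its smooth vector fields and $\Omega(M)=\bigoplus_p\Omega^p(M)$ its differential forms. For a vector-valued form $K\in\Omega^{k+1}(M;TM)$ let $\imath_K:\Omega^p(M)\to\Omega^{p+k}(M)$ be the insertion: it vanishes on functions, and for $p\ge 1$ $$(\imath_K\omega)(Z_1,\dots,Z_{k+p})=\sum_{\sigma\in S_{k+1,p-1}}\mathrm{sgn}(\sigma)\,\omega\big(K(Z_{\sigma(1)},\dots,Z_{\sigma(k+1)}),Z_{\sigma(k+2)},\dots,Z_{\sigma(k+p)}\big),$$ where the sum runs over shuffles. For $N\in\Omega^1(M;TM)$, i.e. an endomorphism of $TM$, put $\mathcal L_N=\imath_N\circ d-d\circ\imath_N$ and let $$T_N(X,Y)=[NX,NY]-N[NX,Y]-N[X,NY]+N^2[X,Y]$$ be the Nijenhuis torsion of $N$, a vector-valued 2-form. A cohomology operator is a derivation $D$ of degree $1$ of $\Omega(M)$, i.e. a linear map with $D(\Omega^p(M))\subset\Omega^{p+1}(M)$ and $D(\alpha\wedge\beta)=D\alpha\wedge\beta+(-1)^{|\alpha|}\alpha\wedge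 D\beta$, such that $D^2=0$. **Theorem.** Let $N\in\Omega^1(M;TM)$ satisfy $N^2=N$, let $\mathrm{Im}\,N$ be involutive (the Lie bracket of two sections of $\mathrm{Im}\,N$ is a section of $\mathrm{Im}\,N$), and put $L=-T_N\in\Omega^2(M;TM)$. Then $$D_1=\mathcal L_N+\imath_L\qquad\text{and}\qquad D_2=\imath_L$$ are derivations of degree $1$ of $\Omega(M)$ and are cohomology operators: $D_1^2=0=D_2^2$. The same holds in the complex case: for an idempotent endomorphism $N$ of $T^{\mathbb C}M=TM\oplus iTM$ with $\mathrm{Im}\,N$ involutive (for the $\mathbb C$-bilinear extension of the Lie bracket), acting on the complex-valued forms $\Omega_{\mathbb C}(M)$, with the same formulas extended $\mathbb C$-linearly. -/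

import Mathlib

open scoped Manifold
noncomputable section

namespace LieRinehart

/-- `Ω^p`: the alternating `A`-multilinear maps `L^p → A`. For `A = C^∞(M)` and `L` the module of
smooth vector fields on a (Hausdorff) manifold these are the differential `p`-forms, and for
`A = C^∞(M, ℂ)` and `L` the complex vector fields they are the complex `p`-forms. -/
abbrev Form (A L : Type*) [CommRing A] [AddCommGroup L] [Module A L] (p : ℕ) : Type _ :=
  L [⋀^Fin p]→ₗ[A] A

/-- `Ω^k(M; TM)`: the vector-valued `k`-forms, alternating `A`-multilinear maps `L^k → L`. -/
abbrev VectorForm (A L : Type*) [CommRing A] [AddCommGroup L] [Module A L] (k : ℕ) : Type _ :=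
  L [⋀^Fin k]→ₗ[A] L

section Tensorial

instance Form.isScalarTower (R A L : Type*) [CommRing R] [CommRing A] [Algebra R A]
    [AddCommGroup L] [Module A L] (p : ℕ) : IsScalarTower R A (Form A L p) where
  smul_assoc r a ω := by ext v; simp

variable {A L : Type*} [CommRing A] [AddCommGroup L] [Module A L]

/-- Transport of a form along an equality of degrees. -/
def Form.cast {p q : ℕ} (h : p = q) (ω : Form A L p) : Form A L q :=
  ω.domDomCongr (finCongr h)

/-- The exterior product
`(α ∧ β)(X₁, …, X_{p+q}) = ∑ sgn(σ) α(X_{σ(1)}, …, X_{σ(p)}) β(X_{σ(p+1)}, …, X_{σ(p+q)})`,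
the sum being over `(p, q)`-shuffles. -/
def Form.wedge {p q : ℕ} (α : Form A L p) (β : Form A L q) : Form A L (p + q) :=
  ((LinearMap.mul' A A).compAlternatingMap (α.domCoprod β)).domDomCongr finSumFinEquiv

/-- The alternating map `(v₁, …, v_q) ↦ (x ↦ ω(x, v₁, …, v_q))`. -/
def Form.curryHead {q : ℕ} (ω : Form A L (q + 1)) : L [⋀^Fin q]→ₗ[A] Module.Dual A L where
  toFun v :=
    { toFun := fun x => ω (Matrix.vecCons x v)
      map_add' := fun x y => DFunLike.congr_fun (ω.curryLeft.map_add x y) v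
      map_smul' := fun a x => DFunLike.congr_fun (ω.curryLeft.map_smul a x) v }
  map_update_add' v i x y := LinearMap.ext fun z => (ω.curryLeft z).map_update_add v i x y
  map_update_smul' v i a x := LinearMap.ext fun z => (ω.curryLeft z).map_update_smul v i a x
  map_eq_zero_of_eq' v _ _ h hij :=
    LinearMap.ext fun z => (ω.curryLeft z).map_eq_zero_of_eq v h hij

/-- The insertion `ι_K` on forms of positive degree `q + 1`, see `insertion`: the tensors
`K(Z_{σ(1)}, …, Z_{σ(k+1)}) ⊗ ω(·, Z_{σ(k+2)}, …, Z_{σ(k+1+q)})` are summed over shuffles and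
contracted. -/
def insertionAux {k q : ℕ} (K : VectorForm A L (k + 1)) :
    Form A L (q + 1) →ₗ[A] Form A L (q + 1 + k) where
  toFun ω := Form.cast (by omega) <|
    ((contractRight A L).compAlternatingMap (K.domCoprod ω.curryHead)).domDomCongr finSumFinEquiv
  map_add' ω η := by
    have : (ω + η).curryHead = ω.curryHead + η.curryHead := by ext; rfl
    ext v
    simp only [this, Form.cast]
    have h := AlternatingMap.domCoprod'.map_add (K ⊗ₜ[A] ω.curryHead) (K ⊗ₜ[A] η.curryHead)
    rw [← TensorProduct.tmul_add] at h
    simp only [AlternatingMap.domCoprod'_apply] at h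
    simp [h, -AlternatingMap.domCoprod_apply]
  map_smul' a ω := by
    have : (a • ω).curryHead = a • ω.curryHead := by ext; rfl
    ext v
    simp only [this, Form.cast]
    have h := AlternatingMap.domCoprod'.map_smul a (K ⊗ₜ[A] ω.curryHead)
    rw [← TensorProduct.tmul_smul] at h
    simp only [AlternatingMap.domCoprod'_apply] at h
    simp [h, -AlternatingMap.domCoprod_apply]

/-- The insertion `ι_K : Ω^p → Ω^{p+k}` of a vector-valued `(k+1)`-form `K`: zero on functions, and
`(ι_K ω)(Z₁, …, Z_{k+p}) =
  ∑ sgn(σ) ω(K(Z_{σ(1)}, …, Z_{σ(k+1)}), Z_{σ(k+2)}, …, Z_{σ(k+p)})`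
for `p ≥ 1`, the sum being over `(k+1, p-1)`-shuffles. -/
def insertion {k : ℕ} (K : VectorForm A L (k + 1)) : (p : ℕ) → Form A L p →ₗ[A] Form A L (p + k)
  | 0 => 0
  | _ + 1 => insertionAux K
end Tensorial


section Differential

open Finset in
/-- The right-hand side of the formula
`dω(X₀, …, X_p) = ∑ᵢ (-1)^i Xᵢ(ω(X₀, …, X̂ᵢ, …, X_p)) +
  ∑_{i<j} (-1)^{i+j} ω([Xᵢ, Xⱼ], X₀, …, X̂ᵢ, …, X̂ⱼ, …, X_p)`.
In the second sum the pair `i < j` is encoded as `(i.castSucc, j.succ)` with `i ≤ j`, which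
changes the parity of the exponent and hence the sign in front of the sum. -/
def koszul {A L : Type*} [CommRing A] [LieRing L] [Module A L] [LieRingModule L A] :
    {p : ℕ} → Form A L p → (Fin (p + 1) → L) → A
  | 0, f, X => ⁅X 0, f ![]⁆
  | q + 1, ω, X =>
      (∑ i : Fin (q + 2), (-1 : ℤ) ^ (i : ℕ) • ⁅X i, ω (i.removeNth X)⁆) -
        ∑ i : Fin (q + 1), ∑ j ≥ i, (-1 : ℤ) ^ (i + j : ℕ) •
          ω (Matrix.vecCons ⁅X i.castSucc, X j.succ⁆ (j.removeNth (i.castSucc.removeNth X)))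

variable {R A L : Type*} [Field R] [CommRing A] [Algebra R A]
  [LieRing L] [LieAlgebra R L] [Module A L] [LieRingModule L A]
  [LieRinehartRing A L] [LieRinehartAlgebra R A L]

variable (R) in
/-- A form regarded as an `R`-multilinear alternating map. -/
def Form.restrictBase {p : ℕ} (ω : Form A L p) : L [⋀^Fin p]→ₗ[R] A where
  toMultilinearMap := ω.toMultilinearMap.restrictScalars R
  map_eq_zero_of_eq' v _ _ h hij := ω.map_eq_zero_of_eq v h hij

variable (R) in
@[simp] lemma Form.restrictBase_apply {p : ℕ} (ω : Form A L p) (v : Fin p → L) :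
    ω.restrictBase R v = ω v := rfl

variable [CharZero R]

variable (R) in
/-- The first sum in `koszul`, as an `R`-multilinear alternating map. -/
def koszulAux₁ {p : ℕ} (ω : Form A L p) : L [⋀^Fin (p + 1)]→ₗ[R] A :=
  AlternatingMap.alternatizeUncurryFin
    { toFun := fun x => (LieModule.toEnd R L A x).compAlternatingMap (ω.restrictBase R)
      map_add' := fun x y => by ext v; simp
      map_smul' := fun a x => by ext v; simp }

variable (R) in
/-- Twice the second sum in `koszul`, as an `R`-multilinear alternating map. -/
def koszulAux₂ {q : ℕ} (ω : Form A L (q + 1)) : L [⋀^Fin (q + 2)]→ₗ[R] A :=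
  AlternatingMap.alternatizeUncurryFin (AlternatingMap.alternatizeUncurryFinLM ∘ₗ
    (LinearMap.mk₂ R (fun x y => (ω.restrictBase R).curryLeft ⁅x, y⁆)
      (fun x y z => by simp) (fun a x y => by simp) (fun x y z => by simp) (fun a x y => by simp)))

variable (R) in
/-- `koszul ω` as an `R`-multilinear alternating map. -/
def koszulAux : {p : ℕ} → Form A L p → L [⋀^Fin (p + 1)]→ₗ[R] A
  | 0, f => koszulAux₁ R f
  | _ + 1, ω => koszulAux₁ R ω - (2⁻¹ : R) • koszulAux₂ R ω

lemma koszulAux_apply {p : ℕ} (ω : Form A L p) (X : Fin (p + 1) → L) :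
    koszulAux R ω X = koszul ω X := by
  cases p with
  | zero =>
    simp only [koszulAux, koszulAux₁, koszul, AlternatingMap.alternatizeUncurryFin_apply]
    simp
    congr 2
    exact Subsingleton.elim _ _
  | succ q =>
    have h2 : koszulAux₂ R ω X = (2 : R) • ∑ i : Fin (q + 1), ∑ j ∈ Finset.Ici i, (-1 : ℤ) ^ (i + j : ℕ) •
          ω (Matrix.vecCons ⁅X i.castSucc, X j.succ⁆ (j.removeNth (i.castSucc.removeNth X))) := by
      rw [koszulAux₂, AlternatingMap.alternatizeUncurryFin_alternatizeUncurryFinLM_comp_apply,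
        Finset.smul_sum]
      refine Finset.sum_congr rfl fun i _ => ?_
      rw [Finset.smul_sum]
      refine Finset.sum_congr rfl fun j _ => ?_
      rw [smul_comm]
      congr 1
      simp only [LinearMap.mk₂_apply]
      rw [← lie_skew (X j.succ), map_neg, AlternatingMap.neg_apply, sub_neg_eq_add, two_smul]
      rfl
    simp only [koszulAux, AlternatingMap.sub_apply, AlternatingMap.smul_apply, h2]
    rw [smul_smul, inv_mul_cancel₀ two_ne_zero, one_smul]
    simp only [koszulAux₁, koszul, AlternatingMap.alternatizeUncurryFin_apply]
    congr 1

lemma koszulAux_cons_smul {p : ℕ} (ω : Form A L p) (a : A) (x : L) (v : Fin p → L) :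
    koszulAux R ω (Matrix.vecCons (a • x) v) = a • koszulAux R ω (Matrix.vecCons x v) := by
  simp only [koszulAux_apply]
  cases p with
  | zero => simp [koszul]
  | succ q =>
    have e0 : Fin.removeNth 0 (Matrix.vecCons (a • x) v) = v := by ext i; simp [Fin.removeNth]
    have e0' : Fin.removeNth 0 (Matrix.vecCons x v) = v := by ext i; simp [Fin.removeNth]
    have e1 (i : Fin (q + 1)) (y : L) :
        Fin.removeNth i.succ (Matrix.vecCons y v) = Matrix.vecCons y (i.removeNth v) := by
      ext j; refine Fin.cases ?_ (fun j => ?_) j <;> simp [Fin.removeNth]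
    have hc (b : A) (y : L) (w : Fin q → L) :
        ω (Matrix.vecCons (b • y) w) = b * ω (Matrix.vecCons y w) :=
      DFunLike.congr_fun (ω.curryLeft.map_smul b y) w
    have hadd (y z : L) (w : Fin q → L) : ω (Matrix.vecCons (y + z) w) =
        ω (Matrix.vecCons y w) + ω (Matrix.vecCons z w) :=
      DFunLike.congr_fun (ω.curryLeft.map_add y z) w
    have hT (i : Fin q) (j : Fin (q + 1)) (hj : i.succ ≤ j) (w : L) :
        ω (Matrix.vecCons w (j.removeNth (i.castSucc.succ.removeNth (Matrix.vecCons (a • x) v)))) =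
        a * ω (Matrix.vecCons w (j.removeNth (i.castSucc.succ.removeNth (Matrix.vecCons x v)))) := by
      cases q with
      | zero => exact i.elim0
      | succ q =>
        obtain ⟨j, rfl⟩ : ∃ j' : Fin (q + 1), j = j'.succ :=
          Fin.exists_succ_eq.2 (by rintro rfl; simp at hj) |>.imp fun _ h => h.symm
        have e2 (y : L) (u : Fin (q + 1) → L) :
            Fin.removeNth j.succ (Matrix.vecCons y u) = Matrix.vecCons y (j.removeNth u) := by
          ext k; refine Fin.cases ?_ (fun k => ?_) k <;> simp [Fin.removeNth]
        rw [e1, e1, e2, e2]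
        exact DFunLike.congr_fun ((ω.curryLeft w).curryLeft.map_smul a x) _
    simp only [koszul]
    rw [Fin.sum_univ_succ, Fin.sum_univ_succ (n := q + 1),
      Fin.sum_univ_succ (n := q) (f := fun i => ∑ j ∈ Finset.Ici i, _),
      Fin.sum_univ_succ (n := q) (f := fun i => ∑ j ∈ Finset.Ici i, _)]
    simp only [Fin.castSucc_zero, e0, e0', e1, Matrix.cons_val_zero, Matrix.cons_val_succ,
      Fin.val_zero, pow_zero, one_smul, Fin.castSucc_succ, zero_add]
    have hI : Finset.Ici (0 : Fin (q + 1)) = Finset.univ := by ext; simp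
    have h3 : ∑ i : Fin q, ∑ j ∈ Finset.Ici i.succ, (-1 : ℤ) ^ ((i.succ : ℕ) + j) •
          ω (Matrix.vecCons ⁅v i.castSucc, v j⁆
            (j.removeNth (i.castSucc.succ.removeNth (Matrix.vecCons (a • x) v)))) =
        a * ∑ i : Fin q, ∑ j ∈ Finset.Ici i.succ, (-1 : ℤ) ^ ((i.succ : ℕ) + j) •
          ω (Matrix.vecCons ⁅v i.castSucc, v j⁆
            (j.removeNth (i.castSucc.succ.removeNth (Matrix.vecCons x v)))) := by
      simp only [Finset.mul_sum]
      refine Finset.sum_congr rfl fun i _ => Finset.sum_congr rfl fun j hj => ?_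
      rw [hT i j (Finset.mem_Ici.1 hj), mul_smul_comm]
    have h4 (j : Fin (q + 1)) : ⁅a • x, v j⁆ = a • ⁅x, v j⁆ + (-⁅v j, a⁆) • x := by
      rw [← lie_skew, LieRinehartRing.leibniz_smul_right, ← lie_skew x, neg_add, smul_neg, neg_smul]
    simp only [e1] at h3
    rw [h3]
    simp only [h4, hc, hadd, hI]
    simp only [LieRinehartRing.lie_smul_eq_mul,
      LieRinehartRing.leibniz_mul_right, smul_add, Finset.sum_add_distrib, smul_eq_mul,
      mul_sub, mul_add, Finset.mul_sum, mul_smul_comm, Fin.val_succ, pow_succ, mul_neg, mul_one,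
      neg_smul, neg_mul, smul_neg, Finset.sum_neg_distrib]
    ring

lemma koszulAux_update_smul {p : ℕ} (ω : Form A L p) (v : Fin (p + 1) → L) (i : Fin (p + 1)) (a : A) (x : L) :
    koszulAux R ω (Function.update v i (a • x)) = a • koszulAux R ω (Function.update v i x) := by
  have h (y : L) : Function.update v i y = i.insertNth y (i.removeNth v) := by
    simp
  rw [h, h, AlternatingMap.map_insertNth, AlternatingMap.map_insertNth, koszulAux_cons_smul, smul_comm]

variable (R) in
/-- The exterior differential `d : Ω^p → Ω^{p+1}`. -/
def d (p : ℕ) : Form A L p →ₗ[R] Form A L (p + 1) where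
  toFun ω :=
    { toFun := koszul ω
      map_update_add' := by
        intro _ v i x y
        simp only [← koszulAux_apply (R := R)]
        exact (koszulAux R ω).map_update_add v i x y
      map_update_smul' := by
        intro inst v i a x
        obtain rfl : inst = instDecidableEqFin _ := Subsingleton.elim _ _
        simp only [← koszulAux_apply (R := R)]
        exact koszulAux_update_smul ω v i a x
      map_eq_zero_of_eq' := fun v i j h hij => by
        rw [← koszulAux_apply (R := R)]
        exact (koszulAux R ω).map_eq_zero_of_eq v h hij }
  map_add' ω η := by
    ext X
    cases p with
    | zero => simp [koszul]
    | succ q => 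
      simp [koszul, Finset.sum_add_distrib]
      abel
  map_smul' a ω := by
    ext X
    cases p with
    | zero => simp [koszul]
    | succ q => 
      simp [koszul, Finset.smul_sum, smul_sub]

end Differential

section Derivations

variable {R A L : Type*} [Field R] [CharZero R] [CommRing A] [Algebra R A]
  [LieRing L] [LieAlgebra R L] [Module A L] [LieRingModule L A]
  [LieRinehartRing A L] [LieRinehartAlgebra R A L]

/-- The insertion `ι_N` of a vector-valued 1-form `N`, given as an `A`-linear endomorphism of `L`. -/
def insertionOne (N : L →ₗ[A] L) (p : ℕ) : Form A L p →ₗ[A] Form A L p :=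
  insertion (k := 0) (AlternatingMap.ofSubsingleton A L L (0 : Fin 1) N) p

variable (R) in
/-- The Lie derivative `𝓛_N = [ι_N, d] = ι_N ∘ d - d ∘ ι_N` along a vector-valued 1-form `N`. -/
def lieDerivative (N : L →ₗ[A] L) (p : ℕ) : Form A L p →ₗ[R] Form A L (p + 1) :=
  (insertionOne N (p + 1)).restrictScalars R ∘ₗ d R p -
    d R p ∘ₗ (insertionOne N p).restrictScalars R

lemma smul_lie_eq (a : A) (x y : L) : ⁅a • x, y⁆ = a • ⁅x, y⁆ - ⁅y, a⁆ • x := by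
  rw [← lie_skew, LieRinehartRing.leibniz_smul_right, ← lie_skew x, neg_add, smul_neg,
    sub_eq_add_neg]

/-- The Nijenhuis torsion `T_N(X, Y) = [NX, NY] - N[NX, Y] - N[X, NY] + N²[X, Y]`. -/
def torsion (N : L →ₗ[A] L) : VectorForm A L 2 where
  toFun v := ⁅N (v 0), N (v 1)⁆ - N ⁅N (v 0), v 1⁆ - N ⁅v 0, N (v 1)⁆ + N (N ⁅v 0, v 1⁆)
  map_update_add' v i X Y := by
    fin_cases i
    · simp only [Fin.zero_eta, Function.update_self, ne_eq, one_ne_zero, not_false_eq_true,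
        Function.update_of_ne, map_add, add_lie]
      abel
    · simp only [Fin.mk_one, Function.update_self, ne_eq, zero_ne_one, not_false_eq_true,
        Function.update_of_ne, map_add, lie_add]
      abel
  map_update_smul' v i a X := by
    fin_cases i
    · simp only [Fin.zero_eta, Function.update_self, ne_eq, one_ne_zero, not_false_eq_true,
        Function.update_of_ne, map_smul, smul_lie_eq, map_sub]
      module
    · simp only [Fin.mk_one, Function.update_self, ne_eq, zero_ne_one, not_false_eq_true,
        Function.update_of_ne, map_smul, LieRinehartRing.leibniz_smul_right, map_add]
      module
  map_eq_zero_of_eq' v i j h hij := by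
    have h' : v 0 = v 1 := by
      fin_cases i <;> fin_cases j <;> simp_all
    simp only [h', lie_self, map_zero, ← lie_skew (v 1) (N (v 1)), map_neg]
    abel

/-- `D` is a derivation of degree `1` of `Ω = ⨁ Ω^p`:
`D(α ∧ β) = D(α) ∧ β + (-1)^p α ∧ D(β)` for `α` of degree `p`. -/
structure IsDerivationOfDegreeOne (D : (p : ℕ) → Form A L p →ₗ[R] Form A L (p + 1)) : Prop where
  leibniz : ∀ (p q : ℕ) (α : Form A L p) (β : Form A L q),
    D (p + q) (α.wedge β) =
      ((D p α).wedge β).cast (Nat.add_right_comm p 1 q) + (-1 : ℤ) ^ p • α.wedge (D q β)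

/-- A cohomology operator: a derivation `D` of degree `1` with `D² = 0`. -/
structure IsCohomologyOperator (D : (p : ℕ) → Form A L p →ₗ[R] Form A L (p + 1)) : Prop
    extends IsDerivationOfDegreeOne D where
  sq_eq_zero : ∀ (p : ℕ) (ω : Form A L p), D (p + 1) (D p ω) = 0

/-- A module of sections closed under the bracket. -/
def IsInvolutive (S : Submodule A L) : Prop := ∀ X ∈ S, ∀ Y ∈ S, ⁅X, Y⁆ ∈ S

end Derivations
end LieRinehart

section Real

open scoped ContDiff
open VectorField

variable {E : Type*} [NormedAddCommGroup E] [NormedSpace ℝ E]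
  {H : Type*} [TopologicalSpace H] (I : ModelWithCorners ℝ E H)
  (M : Type*) [TopologicalSpace M] [ChartedSpace H M]

/-- The ring `C^∞(M)`. -/
abbrev SmoothFunction : Type _ := C^∞⟮I, M; ℝ⟯

/-- Smooth vector fields: the smooth sections of the tangent bundle. -/
abbrev SmoothVectorField [IsManifold I ∞ M] : Type _ :=
  Cₛ^∞⟮I; E, (TangentSpace I : M → Type _)⟯

variable {I M} [IsManifold I ∞ M]

namespace SmoothVectorField

instance : SMul (SmoothFunction I M) (SmoothVectorField I M) where
  smul f X := ⟨fun x => f x • X x, f.contMDiff.smul_section X.contMDiff⟩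

@[simp] lemma smul_apply (f : SmoothFunction I M) (X : SmoothVectorField I M) (x : M) :
    (f • X) x = f x • X x := rfl

instance : Module (SmoothFunction I M) (SmoothVectorField I M) where
  one_smul X := by ext x; exact one_smul ℝ (X x)
  mul_smul f g X := by ext x; exact mul_smul (f x) (g x) (X x)
  smul_zero f := by ext x; exact smul_zero (f x)
  smul_add f X Y := by ext x; exact smul_add (f x) (X x) (Y x)
  add_smul f g X := by ext x; exact add_smul (f x) (g x) (X x)
  zero_smul X := by ext x; exact zero_smul ℝ (X x)

instance : IsScalarTower ℝ (SmoothFunction I M) (SmoothVectorField I M) where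
  smul_assoc c f X := by ext x; exact smul_assoc c (f x) (X x)

lemma contMDiff_apply (X : SmoothVectorField I M) (f : SmoothFunction I M) :
    ContMDiff I 𝓘(ℝ, ℝ) ∞ fun x => mvfderiv I f x (X x) := by
  have h := (f.contMDiff.contMDiff_tangentMap (m := ∞) (by simp)).comp X.contMDiff
  exact (contMDiff_snd_tangentBundle_modelSpace ℝ 𝓘(ℝ, ℝ)).comp h

/-- The action of a vector field on a function, `X f = df(X)`. -/
instance : Bracket (SmoothVectorField I M) (SmoothFunction I M) where
  bracket X f := ⟨fun x => mvfderiv I f x (X x), contMDiff_apply X f⟩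

lemma lie_apply (X : SmoothVectorField I M) (f : SmoothFunction I M) (x : M) :
    ⁅X, f⁆ x = mvfderiv I f x (X x) := rfl

lemma two_le_infty : minSmoothness ℝ 2 ≤ ∞ := by
  rw [minSmoothness_of_isRCLikeNormedField]
  exact ENat.LEInfty.out

variable [CompleteSpace E]

/-- The Lie bracket of smooth vector fields. -/
instance : Bracket (SmoothVectorField I M) (SmoothVectorField I M) where
  bracket X Y := ⟨mlieBracket I X Y, by
    have : IsManifold I (((⊤ : ℕ∞) : WithTop ℕ∞) + 1) M := ‹IsManifold I ∞ M›
    have : IsManifold I (minSmoothness ℝ 2) M := by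
      rw [minSmoothness_of_isRCLikeNormedField]; infer_instance
    exact ContDiff.mlieBracket_vectorField (n := ⊤) X.contMDiff Y.contMDiff (by simp)⟩

lemma bracket_apply (X Y : SmoothVectorField I M) (x : M) : ⁅X, Y⁆ x = mlieBracket I X Y x := rfl

instance : LieRing (SmoothVectorField I M) where
  add_lie X Y Z := by
    ext x; exact mlieBracket_add_left X.mdifferentiableAt Y.mdifferentiableAt
  lie_add X Y Z := by
    ext x; exact mlieBracket_add_right Y.mdifferentiableAt Z.mdifferentiableAt
  lie_self X := by ext x; simp [bracket_apply]
  leibniz_lie X Y Z := by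
    ext x
    have : IsManifold I (minSmoothness ℝ 3) M := by
      rw [minSmoothness_of_isRCLikeNormedField]; infer_instance
    exact leibniz_identity_mlieBracket_apply (X.contMDiff.of_le two_le_infty x)
      (Y.contMDiff.of_le two_le_infty x) (Z.contMDiff.of_le two_le_infty x)

instance : LieAlgebra ℝ (SmoothVectorField I M) where
  lie_smul c X Y := by
    ext x; exact mlieBracket_const_smul_right Y.mdifferentiableAt

/-- The Lie bracket acts on functions as the commutator. -/
lemma lie_lie_apply (X Y : SmoothVectorField I M) (f : SmoothFunction I M) :
    ⁅⁅X, Y⁆, f⁆ = ⁅X, ⁅Y, f⁆⁆ - ⁅Y, ⁅X, f⁆⁆ := by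
  have hinf : (∞ : WithTop ℕ∞) ≠ 0 := by simp
  have h2 : IsManifold I (minSmoothness ℝ 2) M := by
      rw [minSmoothness_of_isRCLikeNormedField]; infer_instance
  have h3 : IsManifold I (minSmoothness ℝ 3) M := by
      rw [minSmoothness_of_isRCLikeNormedField]; infer_instance
  have h4 : IsManifold I (((⊤ : ℕ∞) : WithTop ℕ∞) + 1) M := ‹IsManifold I ∞ M›
  -- the product rule, applied to a local vector field `Z`
  have key (V : SmoothVectorField I M) (g : SmoothFunction I M) (Z : Π x : M, TangentSpace I x)
      (x : M) (hZ : ContMDiffAt I I.tangent ∞ (fun y => (Z y : TangentBundle I M)) x) :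
      mlieBracket I V ((g : M → ℝ) • Z) x = ⁅V, g⁆ x • Z x + g x • mlieBracket I V Z x :=
    mlieBracket_smul_right (g.contMDiff.mdifferentiableAt hinf) (hZ.mdifferentiableAt hinf)
  ext x
  rw [ContMDiffMap.coe_sub, Pi.sub_apply]
  by_cases hv : ∃ v : TangentSpace I x, v ≠ 0
  swap
  · push Not at hv
    simp only [lie_apply, hv, map_zero, sub_zero]
  obtain ⟨v, hv⟩ := hv
  set Z : Π x : M, TangentSpace I x := FiberBundle.extend E v with hZdef
  have hZx : Z x = v := FiberBundle.extend_apply_self E v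
  have hZ : ContMDiffAt I I.tangent ∞ (fun y => (Z y : TangentBundle I M)) x :=
    FiberBundle.contMDiffAt_extend I E v
  have hZe : ∀ᶠ y in nhds x, ContMDiffAt I I.tangent ∞ (fun y => (Z y : TangentBundle I M)) y := by
    obtain ⟨s, hs, h⟩ := FiberBundle.exists_contMDiffOn_extend (k := ∞) I E v
    filter_upwards [eventually_mem_nhds_iff.2 hs] with y hy
    exact h.contMDiffAt hy
  have hbr (V : SmoothVectorField I M) :
      ContMDiffAt I I.tangent ∞ (fun y => (mlieBracket I V Z y : TangentBundle I M)) x :=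
    ContMDiffAt.mlieBracket_vectorField (n := ⊤) (V.contMDiff x) hZ (by simp)
  have hsm (g : SmoothFunction I M) {W : Π x : M, TangentSpace I x}
      (hW : ContMDiffAt I I.tangent ∞ (fun y => (W y : TangentBundle I M)) x) :
      ContMDiffAt I I.tangent ∞ (fun y => (((g : M → ℝ) • W) y : TangentBundle I M)) x :=
    g.contMDiff.contMDiffAt.smul_section hW
  have main (V W : SmoothVectorField I M) :
      mlieBracket I V (mlieBracket I W ((f : M → ℝ) • Z)) x =
        ⁅V, ⁅W, f⁆⁆ x • v + ⁅W, f⁆ x • mlieBracket I V Z x +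
          (⁅V, f⁆ x • mlieBracket I W Z x + f x • mlieBracket I V (mlieBracket I W Z) x) := by
    have he : mlieBracket I W ((f : M → ℝ) • Z) =ᶠ[nhds x] ⇑(⁅W, f⁆ : SmoothFunction I M) • Z + (f : M → ℝ) • mlieBracket I W Z := by
      filter_upwards [hZe] with y hy
      exact key W f Z y hy
    rw [Filter.EventuallyEq.rfl.mlieBracket_vectorField_eq he,
      mlieBracket_add_right ((hsm _ hZ).mdifferentiableAt hinf)
        ((hsm _ (hbr W)).mdifferentiableAt hinf), key _ _ _ _ hZ, key _ _ _ _ (hbr W), hZx]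
  have hJ := leibniz_identity_mlieBracket_apply (X.contMDiff.of_le two_le_infty x)
    (Y.contMDiff.of_le two_le_infty x) ((hsm f hZ).of_le two_le_infty)
  have hJ' := leibniz_identity_mlieBracket_apply (X.contMDiff.of_le two_le_infty x)
    (Y.contMDiff.of_le two_le_infty x) (hZ.of_le two_le_infty)
  have hXY : mlieBracket I (mlieBracket I X Y) ((f : M → ℝ) • Z) x =
      ⁅⁅X, Y⁆, f⁆ x • v + f x • mlieBracket I (mlieBracket I X Y) Z x := by
    rw [← hZx]; exact key ⁅X, Y⁆ f Z x hZ
  rw [main, main, hXY, hJ'] at hJ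
  have hfin : (⁅⁅X, Y⁆, f⁆ x - (⁅X, ⁅Y, f⁆⁆ x - ⁅Y, ⁅X, f⁆⁆ x)) • v = 0 := by
    rw [← sub_eq_zero] at hJ
    rw [← neg_eq_zero, ← hJ]
    module
  exact sub_eq_zero.1 ((smul_eq_zero.1 hfin).resolve_right hv)

instance : LieRingModule (SmoothVectorField I M) (SmoothFunction I M) where
  add_lie X Y f := by ext x; simp [lie_apply]
  lie_add X f g := by
    ext x
    simp only [lie_apply, ContMDiffMap.coe_add]
    rw [mvfderiv_add (f.contMDiff.mdifferentiableAt (by simp))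
      (g.contMDiff.mdifferentiableAt (by simp))]
    rfl
  leibniz_lie X Y f := by rw [lie_lie_apply]; abel

instance : LieRinehartRing (SmoothFunction I M) (SmoothVectorField I M) where
  lie_smul_eq_mul' f g X := by
    ext x
    simp [lie_apply]
  leibniz_mul_right' X f g := by
    ext x
    have := mvfderiv_mul (f.contMDiff.mdifferentiableAt (x := x) (by simp))
      (g.contMDiff.mdifferentiableAt (x := x) (by simp))
    simp only [lie_apply, ContMDiffMap.coe_mul, ContMDiffMap.coe_add, this, Pi.add_apply, Pi.mul_apply, smul_eq_mul]
    simp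
    ring
  leibniz_smul_right' X Y f := by
    ext x
    refine (mlieBracket_smul_right (f.contMDiff.mdifferentiableAt (x := x) (by simp))
      Y.mdifferentiableAt).trans ?_
    rw [add_comm]
    rfl

instance : LieRinehartAlgebra ℝ (SmoothFunction I M) (SmoothVectorField I M) where
  smul_lie c X f := by
    ext x; simp [lie_apply]
  lie_smul c X f := by
    have h : ⁅X, ContMDiffMap.C (I := I) (N := M) (n := ∞) c⁆ = (0 : SmoothFunction I M) := by
      ext x
      exact congrArg (fun φ : TangentSpace I x →L[ℝ] ℝ => φ (X x)) (mvfderiv_const (I := I) c)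
    have h' (g : SmoothFunction I M) : c • g = ContMDiffMap.C (I := I) (N := M) (n := ∞) c * g := rfl
    rw [h', h', LieRinehartRing.leibniz_mul_right, h, zero_mul, add_zero, smul_eq_mul]

end SmoothVectorField
end Real

section Complex

open scoped ContDiff

instance contMDiffRingComplex : ContMDiffRing 𝓘(ℝ, ℂ) ∞ ℂ where
  contMDiff_mul := by
    rw [contMDiff_iff]
    refine ⟨continuous_mul, fun x y => ?_⟩
    simp only [mfld_simps, chartAt_self_eq]
    rw [contDiffOn_univ]
    exact contDiff_mul

variable {E : Type*} [NormedAddCommGroup E] [NormedSpace ℝ E]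
  {H : Type*} [TopologicalSpace H] (I : ModelWithCorners ℝ E H)
  (M : Type*) [TopologicalSpace M] [ChartedSpace H M]

/-- The ring of smooth complex-valued functions on the real manifold `M`. -/
abbrev ComplexSmoothFunction : Type _ := C^∞⟮I, M; 𝓘(ℝ, ℂ), ℂ⟯

/-- Complex vector fields `Z = X + i Y` with `X`, `Y` smooth real vector fields, i.e. smooth sections
of the complexified tangent bundle `TM ⊕ i TM`; the pair `(X, Y)` stands for `X + i Y`. -/
def ComplexSmoothVectorField [IsManifold I ∞ M] : Type _ :=
  SmoothVectorField I M × SmoothVectorField I M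

variable {I M}

namespace ComplexSmoothFunction

instance : Algebra ℂ (ComplexSmoothFunction I M) :=
  RingHom.toAlgebra
    { toFun := fun c => ⟨fun _ => c, contMDiff_const⟩
      map_one' := rfl
      map_mul' := fun _ _ => rfl
      map_zero' := rfl
      map_add' := fun _ _ => rfl }

/-- Real part. -/
def re (f : ComplexSmoothFunction I M) : SmoothFunction I M :=
  ⟨fun x => (f x).re, Complex.reCLM.contDiff.contMDiff.comp f.contMDiff⟩

/-- Imaginary part. -/
def im (f : ComplexSmoothFunction I M) : SmoothFunction I M :=
  ⟨fun x => (f x).im, Complex.imCLM.contDiff.contMDiff.comp f.contMDiff⟩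

/-- The complex function `u + i v`. -/
def mk (u v : SmoothFunction I M) : ComplexSmoothFunction I M :=
  ⟨fun x => (u x : ℂ) + (v x : ℂ) * Complex.I,
    ((Complex.ofRealCLM.contDiff.contMDiff.comp u.contMDiff).add
      ((Complex.ofRealCLM.contDiff.contMDiff.comp v.contMDiff).mul contMDiff_const))⟩

@[simp] lemma re_mk (u v : SmoothFunction I M) : re (mk u v) = u := by
  ext x
  change ((u x : ℂ) + (v x : ℂ) * Complex.I).re = u x
  simp
@[simp] lemma im_mk (u v : SmoothFunction I M) : im (mk u v) = v := by
  ext x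
  change ((u x : ℂ) + (v x : ℂ) * Complex.I).im = v x
  simp
lemma ext_re_im {f g : ComplexSmoothFunction I M} (h₁ : f.re = g.re) (h₂ : f.im = g.im) :
    f = g := by
  ext x
  exact Complex.ext (congrArg (fun u : SmoothFunction I M => u x) h₁)
    (congrArg (fun u : SmoothFunction I M => u x) h₂)
@[simp] lemma re_zero : re (0 : ComplexSmoothFunction I M) = 0 := rfl
@[simp] lemma im_zero : im (0 : ComplexSmoothFunction I M) = 0 := rfl
@[simp] lemma re_one : re (1 : ComplexSmoothFunction I M) = 1 := rfl
@[simp] lemma im_one : im (1 : ComplexSmoothFunction I M) = 0 := rfl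
@[simp] lemma re_add (f g : ComplexSmoothFunction I M) : re (f + g) = re f + re g := rfl
@[simp] lemma im_add (f g : ComplexSmoothFunction I M) : im (f + g) = im f + im g := rfl
@[simp] lemma re_mul (f g : ComplexSmoothFunction I M) :
    re (f * g) = re f * re g - im f * im g := rfl
@[simp] lemma im_mul (f g : ComplexSmoothFunction I M) :
    im (f * g) = re f * im g + im f * re g := rfl
@[simp] lemma re_algebraMap (c : ℂ) :
    re (algebraMap ℂ (ComplexSmoothFunction I M) c) = algebraMap ℝ _ c.re := rfl
@[simp] lemma im_algebraMap (c : ℂ) :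
    im (algebraMap ℂ (ComplexSmoothFunction I M) c) = algebraMap ℝ _ c.im := rfl

end ComplexSmoothFunction

namespace ComplexSmoothVectorField

variable [IsManifold I ∞ M]

instance : AddCommGroup (ComplexSmoothVectorField I M) :=
  inferInstanceAs (AddCommGroup (SmoothVectorField I M × SmoothVectorField I M))

/-- Real part `X` of `Z = X + i Y`. -/
def re (Z : ComplexSmoothVectorField I M) : SmoothVectorField I M := Z.1
/-- Imaginary part `Y` of `Z = X + i Y`. -/
def im (Z : ComplexSmoothVectorField I M) : SmoothVectorField I M := Z.2
/-- The complex vector field `X + i Y`. -/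
def mk (X Y : SmoothVectorField I M) : ComplexSmoothVectorField I M := (X, Y)

@[simp] lemma re_mk (X Y : SmoothVectorField I M) : re (mk X Y) = X := rfl
@[simp] lemma im_mk (X Y : SmoothVectorField I M) : im (mk X Y) = Y := rfl
@[simp] lemma re_zero : re (0 : ComplexSmoothVectorField I M) = 0 := rfl
@[simp] lemma im_zero : im (0 : ComplexSmoothVectorField I M) = 0 := rfl
@[simp] lemma re_add (Z W : ComplexSmoothVectorField I M) : re (Z + W) = re Z + re W := rfl
@[simp] lemma im_add (Z W : ComplexSmoothVectorField I M) : im (Z + W) = im Z + im W := rfl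
lemma ext_re_im {Z W : ComplexSmoothVectorField I M} (h₁ : Z.re = W.re) (h₂ : Z.im = W.im) :
    Z = W := Prod.ext h₁ h₂

/-- The module structure over complex functions,
`(u + i v)(X + i Y) = (u X - v Y) + i (u Y + v X)`. -/
instance : SMul (ComplexSmoothFunction I M) (ComplexSmoothVectorField I M) where
  smul f Z := mk (f.re • Z.re - f.im • Z.im) (f.re • Z.im + f.im • Z.re)

@[simp] lemma re_smul (f : ComplexSmoothFunction I M) (Z : ComplexSmoothVectorField I M) :
    re (f • Z) = f.re • Z.re - f.im • Z.im := rfl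
@[simp] lemma im_smul (f : ComplexSmoothFunction I M) (Z : ComplexSmoothVectorField I M) :
    im (f • Z) = f.re • Z.im + f.im • Z.re := rfl

instance : Module (ComplexSmoothFunction I M) (ComplexSmoothVectorField I M) where
  one_smul Z := ext_re_im (by simp) (by simp)
  mul_smul f g Z := ext_re_im (by simp; module) (by simp; module)
  smul_zero f := ext_re_im (by simp) (by simp)
  smul_add f Z W := ext_re_im (by simp; module) (by simp; module)
  add_smul f g Z := ext_re_im (by simp; module) (by simp; module)
  zero_smul Z := ext_re_im (by simp) (by simp)

instance : Module ℂ (ComplexSmoothVectorField I M) :=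
  Module.compHom _ (algebraMap ℂ (ComplexSmoothFunction I M))

lemma complex_smul_def (c : ℂ) (Z : ComplexSmoothVectorField I M) :
    c • Z = algebraMap ℂ (ComplexSmoothFunction I M) c • Z := rfl

instance : IsScalarTower ℂ (ComplexSmoothFunction I M) (ComplexSmoothVectorField I M) where
  smul_assoc c f Z := by rw [Algebra.smul_def, mul_smul, complex_smul_def]

/-- The action of complex vector fields on complex functions,
`(X + i Y)(u + i v) = (X u - Y v) + i (X v + Y u)`. -/
instance : Bracket (ComplexSmoothVectorField I M) (ComplexSmoothFunction I M) where
  bracket Z f := .mk (⁅Z.re, f.re⁆ - ⁅Z.im, f.im⁆) (⁅Z.re, f.im⁆ + ⁅Z.im, f.re⁆)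

@[simp] lemma re_lie_function (Z : ComplexSmoothVectorField I M) (f : ComplexSmoothFunction I M) :
    ComplexSmoothFunction.re ⁅Z, f⁆ = ⁅Z.re, f.re⁆ - ⁅Z.im, f.im⁆ :=
  ComplexSmoothFunction.re_mk _ _
@[simp] lemma im_lie_function (Z : ComplexSmoothVectorField I M) (f : ComplexSmoothFunction I M) :
    ComplexSmoothFunction.im ⁅Z, f⁆ = ⁅Z.re, f.im⁆ + ⁅Z.im, f.re⁆ :=
  ComplexSmoothFunction.im_mk _ _

variable [CompleteSpace E]

/-- The `ℂ`-bilinear extension of the Lie bracket of vector fields. -/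
instance : Bracket (ComplexSmoothVectorField I M) (ComplexSmoothVectorField I M) where
  bracket Z W := mk (⁅Z.re, W.re⁆ - ⁅Z.im, W.im⁆) (⁅Z.re, W.im⁆ + ⁅Z.im, W.re⁆)

@[simp] lemma re_lie (Z W : ComplexSmoothVectorField I M) :
    re ⁅Z, W⁆ = ⁅Z.re, W.re⁆ - ⁅Z.im, W.im⁆ := rfl
@[simp] lemma im_lie (Z W : ComplexSmoothVectorField I M) :
    im ⁅Z, W⁆ = ⁅Z.re, W.im⁆ + ⁅Z.im, W.re⁆ := rfl
instance : LieRing (ComplexSmoothVectorField I M) where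
  add_lie Z W V := ext_re_im (by simp; abel) (by simp; abel)
  lie_add Z W V := ext_re_im (by simp; abel) (by simp; abel)
  lie_self Z := ext_re_im (by simp) (by
    rw [im_lie, ← lie_skew Z.im Z.re, add_neg_cancel]
    rfl)
  leibniz_lie Z W V := ext_re_im
    (by simp [lie_sub, sub_lie]; abel)
    (by simp [lie_sub, sub_lie]; abel)

instance : LieRingModule (ComplexSmoothVectorField I M) (ComplexSmoothFunction I M) where
  add_lie Z W f := ComplexSmoothFunction.ext_re_im (by simp; abel) (by simp; abel)
  lie_add Z f g := ComplexSmoothFunction.ext_re_im (by simp; abel) (by simp; abel)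
  leibniz_lie Z W f := ComplexSmoothFunction.ext_re_im
    (by simp [lie_sub, sub_lie]; abel)
    (by simp [lie_sub, sub_lie]; abel)

instance : LieRinehartRing (ComplexSmoothFunction I M) (ComplexSmoothVectorField I M) where
  lie_smul_eq_mul' f g Z := ComplexSmoothFunction.ext_re_im
    (by simp [sub_lie]; ring) (by simp [sub_lie]; ring)
  leibniz_mul_right' Z f g := ComplexSmoothFunction.ext_re_im
    (by simp [lie_sub]; ring) (by simp [lie_sub]; ring)
  leibniz_smul_right' Z W f := ext_re_im
    (by simp [lie_sub]; module) (by simp [lie_sub]; module)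

lemma lie_algebraMap (Z : ComplexSmoothVectorField I M) (c : ℂ) :
    ⁅Z, algebraMap ℂ (ComplexSmoothFunction I M) c⁆ = 0 := by
  have h (X : SmoothVectorField I M) (r : ℝ) :
      ⁅X, algebraMap ℝ (SmoothFunction I M) r⁆ = 0 := by
    rw [Algebra.algebraMap_eq_smul_one, lie_smul]
    have := LieRinehartRing.leibniz_mul_right X (1 : SmoothFunction I M) 1
    simp at this
    simp [this]
  exact ComplexSmoothFunction.ext_re_im (by simp [h]) (by simp [h])

instance : LieAlgebra ℂ (ComplexSmoothVectorField I M) where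
  lie_smul c Z W := by
    rw [complex_smul_def, complex_smul_def, LieRinehartRing.leibniz_smul_right, lie_algebraMap,
      zero_smul, add_zero]

instance : LieRinehartAlgebra ℂ (ComplexSmoothFunction I M) (ComplexSmoothVectorField I M) where
  smul_lie c Z f := by
    rw [complex_smul_def, LieRinehartRing.lie_smul_eq_mul, Algebra.smul_def]
  lie_smul c Z f := by
    rw [Algebra.smul_def, Algebra.smul_def, LieRinehartRing.leibniz_mul_right, lie_algebraMap,
      zero_mul, add_zero, smul_eq_mul]

end ComplexSmoothVectorField

end Complex

end

/-! Both operators are treated as exterior differentials of a bracket. Write `i_x` for contraction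
with `x`. A Cartan calculus consists of `D`, operators `lie x`, an anchor `ρ` and a bracket `B` with
`i_x D + D i_x = lie x`, `[lie x, i_y] = i_{B(x,y)}` and `lie x = ρ x` on functions. These relations
determine `D` and `lie` by recursion on the degree.

They alone give the Leibniz rule (`IsCartanCalculus.isDerivationOfDegreeOne`). If moreover `B`
satisfies the Jacobi identity and `ρ` respects brackets, induction on the degree yields `[lie x, lie
y] = lie (B x y)`, then `[lie x, D] = 0`, then `D² = 0` (`IsCartanCalculus.D_D`). No tensoriality of
`B` is needed, so the operators may be checked by formal commutation.

Let `P = 1 - N` and `T` be the torsion. Since `N` is idempotent with involutive image, `T` takes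
values in `Im N` and vanishes as soon as one argument lies in `Im N`. The operator `ι_L` has anchor
`0` and bracket `T`, and every iterated bracket vanishes, so Jacobi is trivial. The operator `𝓛_N +
ι_L` has anchor `N` and bracket `B(x,y) = [Nx,Ny] + P[Nx,y] + P[x,Ny]`, the semidirect product of
`Im N` with `Ker N ≅ L / Im N` through the Bott connection. As `N B(x,y) = [Nx,Ny]`, its Jacobi
identity reduces to that of the Lie bracket.

To avoid bookkeeping with shuffles, forms are read as functions on lists of vectors. There the
exterior product obeys a one-line recursion on the first argument; `onList_shuffleMul` links it to
the definition by shuffles. -/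

noncomputable section

namespace LieRinehart

/-! ### Exterior products: from sums over shuffles to a recursion on lists -/

open TensorProduct in
/-- The exterior product of alternating maps with values in two modules that are paired by `μ`. -/
def shuffleMul {A L M₁ M₂ P : Type*} [CommRing A] [AddCommGroup L] [Module A L]
    [AddCommGroup M₁] [Module A M₁] [AddCommGroup M₂] [Module A M₂] [AddCommGroup P] [Module A P]
    (μ : M₁ ⊗[A] M₂ →ₗ[A] P) {p q : ℕ} (α : L [⋀^Fin p]→ₗ[A] M₁) (β : L [⋀^Fin q]→ₗ[A] M₂) :
    L [⋀^Fin (p + q)]→ₗ[A] P :=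
  (μ.compAlternatingMap (α.domCoprod β)).domDomCongr finSumFinEquiv

section Shuffle

open TensorProduct Equiv.Perm

/-- Laplace expansion along the entry `x`: a permutation is a position `c` for `x` together with a
permutation `e` of the remaining entries. The cycle that brings `c` to `0` accounts for the sign
`(-1) ^ c`. -/
lemma sum_perm_fin_succ {L P : Type*} [AddCommGroup P] {n : ℕ} (f : (Fin (n + 1) → L) → P)
    (x : L) (v : Fin n → L) :
    ∑ σ : Equiv.Perm (Fin (n + 1)), sign σ • f (Matrix.vecCons x v ∘ σ) =
      ∑ c : Fin (n + 1), (-1 : ℤ) ^ (c : ℕ) •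
        ∑ e : Equiv.Perm (Fin n), sign e • f (c.insertNth x (v ∘ e)) := by
  set g : Fin (n + 1) × Equiv.Perm (Fin n) → Equiv.Perm (Fin (n + 1)) :=
    fun ce => decomposeFin.symm (0, ce.2) * Fin.cycleRange ce.1 with hg
  have hg0 (ce) : g ce ce.1 = 0 := by simp [hg]
  have hbij : Function.Bijective g := by
    rw [Fintype.bijective_iff_injective_and_card]
    refine ⟨?_, by simp [Fintype.card_perm, Nat.factorial_succ]⟩
    rintro ⟨c, e⟩ ⟨c', e'⟩ h
    -- The position is recovered from the permutation as the preimage of `0`.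
    obtain rfl : c = c' := by
      have h1 := hg0 (c, e)
      rw [h, ← hg0 (c', e')] at h1
      exact (g (c', e')).injective h1
    simpa [hg] using h
  rw [← hbij.sum_comp, Fintype.sum_prod_type]
  refine Finset.sum_congr rfl fun c _ => ?_
  rw [Finset.smul_sum]
  refine Finset.sum_congr rfl fun e _ => ?_
  have h1 : Matrix.vecCons x v ∘ g (c, e) = c.insertNth x (v ∘ e) := by
    rw [Fin.eq_insertNth_iff]
    refine ⟨by simp [hg], ?_⟩
    ext j
    simp [hg, Fin.removeNth, Fin.cycleRange_succAbove]
  have h2 : sign (g (c, e)) = sign e * (-1) ^ (c : ℕ) := by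
    simp [hg, decomposeFin.symm_sign]
  rw [h1, h2, mul_comm, mul_smul]
  simp [Units.smul_def]

section Lists

variable {A L M₁ M₂ P : Type*} [CommRing A]
  [AddCommGroup M₁] [Module A M₁] [AddCommGroup M₂] [Module A M₂] [AddCommGroup P] [Module A P]
  (μ : M₁ ⊗[A] M₂ →ₗ[A] P)

/-- The exterior product of functions on lists, defined by the derivation property of
`(x, a) ↦ (l ↦ a (x :: l))`. -/
def shuffle : List L → (List L → M₁) → (List L → M₂) → P
  | [], a, b => μ (a [] ⊗ₜ b [])
  | x :: l, a, b => shuffle l (fun m => a (x :: m)) b +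
      shuffle l (fun m => (-1 : ℤ) ^ m.length • a m) (fun m => b (x :: m))

variable {μ} in
lemma shuffle_zero_left (l : List L) (b : List L → M₂) : shuffle μ l (fun _ => 0) b = 0 := by
  induction l generalizing b with
  | nil => simp [shuffle]
  | cons x l ih => simp [shuffle, ih]

variable {μ} in
lemma shuffle_zero_right (l : List L) (a : List L → M₁) : shuffle μ l a (fun _ => 0) = 0 := by
  induction l generalizing a with
  | nil => simp [shuffle]
  | cons x l ih => simp [shuffle, ih]

lemma shuffle_add_left (l : List L) (a a' : List L → M₁) (b : List L → M₂) :
    shuffle μ l (fun m => a m + a' m) b = shuffle μ l a b + shuffle μ l a' b := by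
  induction l generalizing a a' b with
  | nil => simp [shuffle, TensorProduct.add_tmul]
  | cons x l ih => simp only [shuffle, smul_add, ih]; abel

lemma shuffle_add_right (l : List L) (a : List L → M₁) (b b' : List L → M₂) :
    shuffle μ l a (fun m => b m + b' m) = shuffle μ l a b + shuffle μ l a b' := by
  induction l generalizing a b b' with
  | nil => simp [shuffle, TensorProduct.tmul_add]
  | cons x l ih => simp only [shuffle, ih]; abel

lemma shuffle_zsmul_left (l : List L) (n : ℤ) (a : List L → M₁) (b : List L → M₂) :
    shuffle μ l (fun m => n • a m) b = n • shuffle μ l a b := by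
  induction l generalizing a b with
  | nil => simp only [shuffle, ← map_zsmul, TensorProduct.smul_tmul']
  | cons x l ih =>
    have h : ∀ m : List L, (-1 : ℤ) ^ m.length • n • a m = n • (-1 : ℤ) ^ m.length • a m :=
      fun m => smul_comm _ _ _
    simp only [shuffle, h, ih, smul_add]

lemma shuffle_zsmul_right (l : List L) (n : ℤ) (a : List L → M₁) (b : List L → M₂) :
    shuffle μ l a (fun m => n • b m) = n • shuffle μ l a b := by
  induction l generalizing a b with
  | nil => simp [shuffle]
  | cons x l ih => simp only [shuffle, ih, smul_add]

end Lists

variable {A L M₁ M₂ P : Type*} [CommRing A] [AddCommGroup L] [Module A L]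
  [AddCommGroup M₁] [Module A M₁] [AddCommGroup M₂] [Module A M₂] [AddCommGroup P] [Module A P]
  (μ : M₁ ⊗[A] M₂ →ₗ[A] P)

/-- `α ⊗ β` antisymmetrized over all permutations of the arguments. -/
def altSum {p q n : ℕ} (α : L [⋀^Fin p]→ₗ[A] M₁) (β : L [⋀^Fin q]→ₗ[A] M₂) (h : p + q = n)
    (v : Fin n → L) : P :=
  ∑ σ : Equiv.Perm (Fin n), sign σ •
    μ (α (fun i => (v ∘ σ) (Fin.cast h (Fin.castAdd q i))) ⊗ₜ
      β (fun j => (v ∘ σ) (Fin.cast h (Fin.natAdd p j))))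

/-- Each shuffle represents a coset of `S_p × S_q`, and all `p! q!` members of the coset contribute
equally because `α` and `β` are alternating. Full permutation sums are easier to expand than sums
over cosets. -/
lemma factorial_smul_shuffleMul {p q : ℕ} (α : L [⋀^Fin p]→ₗ[A] M₁) (β : L [⋀^Fin q]→ₗ[A] M₂)
    (v : Fin (p + q) → L) :
    (p.factorial * q.factorial) • shuffleMul μ α β v = altSum μ α β rfl v := by
  have h := DFunLike.congr_fun (MultilinearMap.domCoprod_alternization_eq α β)
    (v ∘ finSumFinEquiv)
  simp only [Fintype.card_fin] at h
  have h' := congrArg μ h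
  rw [AlternatingMap.smul_apply, map_nsmul] at h'
  refine h'.symm.trans ?_
  rw [MultilinearMap.alternatization_apply, map_sum, altSum]
  refine Fintype.sum_equiv finSumFinEquiv.permCongr _ _ fun σ => ?_
  rw [Equiv.Perm.sign_permCongr, Units.smul_def, map_zsmul, ← Units.smul_def]
  simp [Function.comp_def, Equiv.permCongr_apply]

/-- The two sums distinguish whether `x` becomes an argument of `α` or of `β`. -/
lemma altSum_cons {p q n : ℕ} (α : L [⋀^Fin p]→ₗ[A] M₁) (β : L [⋀^Fin q]→ₗ[A] M₂)
    (h : p + q = n + 1) (x : L) (v : Fin n → L) :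
    altSum μ α β h (Matrix.vecCons x v) =
      (∑ i : Fin p, (-1 : ℤ) ^ (i : ℕ) • ∑ e : Equiv.Perm (Fin n), sign e •
        μ (α (fun k => (Fin.cast h (Fin.castAdd q i)).insertNth (α := fun _ => L) x (v ∘ e)
            (Fin.cast h (Fin.castAdd q k))) ⊗ₜ
          β (fun k => (Fin.cast h (Fin.castAdd q i)).insertNth (α := fun _ => L) x (v ∘ e)
            (Fin.cast h (Fin.natAdd p k))))) +
      ∑ j : Fin q, (-1 : ℤ) ^ (p + j : ℕ) • ∑ e : Equiv.Perm (Fin n), sign e •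
        μ (α (fun k => (Fin.cast h (Fin.natAdd p j)).insertNth (α := fun _ => L) x (v ∘ e)
            (Fin.cast h (Fin.castAdd q k))) ⊗ₜ
          β (fun k => (Fin.cast h (Fin.natAdd p j)).insertNth (α := fun _ => L) x (v ∘ e)
            (Fin.cast h (Fin.natAdd p k)))) := by
  rw [altSum, sum_perm_fin_succ (fun w => μ (α (fun i => w (Fin.cast h (Fin.castAdd q i))) ⊗ₜ
      β (fun j => w (Fin.cast h (Fin.natAdd p j))))), ← (finCongr h).sum_comp, Fin.sum_univ_add]
  simp

/-- Moving `x` from slot `i` of `α` to the front costs `(-1) ^ i`, which cancels the sign already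
present. The `p + 1` slots therefore contribute the same amount. -/
lemma sum_castAdd_insertNth {p q n : ℕ} (α : L [⋀^Fin (p + 1)]→ₗ[A] M₁)
    (β : L [⋀^Fin q]→ₗ[A] M₂) (h : p + 1 + q = n + 1) (h' : p + q = n) (x : L) (v : Fin n → L) :
    (∑ i : Fin (p + 1), (-1 : ℤ) ^ (i : ℕ) • ∑ e : Equiv.Perm (Fin n), sign e •
        μ (α (fun k => (Fin.cast h (Fin.castAdd q i)).insertNth (α := fun _ => L) x (v ∘ e)
            (Fin.cast h (Fin.castAdd q k))) ⊗ₜ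
          β (fun k => (Fin.cast h (Fin.castAdd q i)).insertNth (α := fun _ => L) x (v ∘ e)
            (Fin.cast h (Fin.natAdd (p + 1) k))))) =
      (p + 1) • altSum μ (α.curryLeft x) β h' v := by
  suffices H : ∀ i : Fin (p + 1), _ = altSum μ (α.curryLeft x) β h' v from
    (Finset.sum_congr rfl fun i _ => H i).trans (by simp)
  intro i
  rw [altSum, Finset.smul_sum]
  refine Finset.sum_congr rfl fun e _ => ?_
  have h1 : (fun k => (Fin.cast h (Fin.castAdd q i)).insertNth (α := fun _ => L) x (v ∘ e)
      (Fin.cast h (Fin.castAdd q k))) =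
      i.insertNth x (fun k => (v ∘ e) (Fin.cast h' (Fin.castAdd q k))) := by
    rw [Fin.eq_insertNth_iff]
    refine ⟨by simp, ?_⟩
    ext k
    have : Fin.cast h (Fin.castAdd q (i.succAbove k)) =
        (Fin.cast h (Fin.castAdd q i)).succAbove (Fin.cast h' (Fin.castAdd q k)) := by
      ext; simp only [Fin.succAbove, Fin.lt_def]
      split_ifs <;> simp_all <;> omega
    simp [Fin.removeNth, this]
  have h2 : (fun k => (Fin.cast h (Fin.castAdd q i)).insertNth (α := fun _ => L) x (v ∘ e)
      (Fin.cast h (Fin.natAdd (p + 1) k))) =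
      (fun k => (v ∘ e) (Fin.cast h' (Fin.natAdd p k))) := by
    ext k
    have : Fin.cast h (Fin.natAdd (p + 1) k) =
        (Fin.cast h (Fin.castAdd q i)).succAbove (Fin.cast h' (Fin.natAdd p k)) := by
      ext; simp only [Fin.succAbove, Fin.lt_def]
      split_ifs <;> simp_all <;> omega
    simp [this]
  rw [h1, h2, AlternatingMap.map_insertNth, smul_comm]
  congr 1
  rw [← TensorProduct.smul_tmul', map_zsmul, smul_smul, ← pow_add, Even.neg_one_pow ⟨_, rfl⟩,
    one_smul]
  rfl

/-- Here `x` also passes the `p` arguments of `α`, so a sign `(-1) ^ p` survives. -/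
lemma sum_natAdd_insertNth {p q n : ℕ} (α : L [⋀^Fin p]→ₗ[A] M₁)
    (β : L [⋀^Fin (q + 1)]→ₗ[A] M₂) (h : p + (q + 1) = n + 1) (h' : p + q = n) (x : L)
    (v : Fin n → L) :
    (∑ j : Fin (q + 1), (-1 : ℤ) ^ (p + j : ℕ) • ∑ e : Equiv.Perm (Fin n), sign e •
        μ (α (fun k => (Fin.cast h (Fin.natAdd p j)).insertNth (α := fun _ => L) x (v ∘ e)
            (Fin.cast h (Fin.castAdd (q + 1) k))) ⊗ₜ
          β (fun k => (Fin.cast h (Fin.natAdd p j)).insertNth (α := fun _ => L) x (v ∘ e)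
            (Fin.cast h (Fin.natAdd p k))))) =
      (q + 1) • (-1 : ℤ) ^ p • altSum μ α (β.curryLeft x) h' v := by
  suffices H : ∀ j : Fin (q + 1), _ = (-1 : ℤ) ^ p • altSum μ α (β.curryLeft x) h' v from
    (Finset.sum_congr rfl fun j _ => H j).trans (by simp)
  intro j
  rw [altSum, Finset.smul_sum, Finset.smul_sum]
  refine Finset.sum_congr rfl fun e _ => ?_
  have h1 : (fun k => (Fin.cast h (Fin.natAdd p j)).insertNth (α := fun _ => L) x (v ∘ e)
      (Fin.cast h (Fin.natAdd p k))) =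
      j.insertNth x (fun k => (v ∘ e) (Fin.cast h' (Fin.natAdd p k))) := by
    rw [Fin.eq_insertNth_iff]
    refine ⟨by simp, ?_⟩
    ext k
    have : Fin.cast h (Fin.natAdd p (j.succAbove k)) =
        (Fin.cast h (Fin.natAdd p j)).succAbove (Fin.cast h' (Fin.natAdd p k)) := by
      ext; simp only [Fin.succAbove, Fin.lt_def]
      split_ifs <;> simp_all <;> omega
    simp [Fin.removeNth, this]
  have h2 : (fun k => (Fin.cast h (Fin.natAdd p j)).insertNth (α := fun _ => L) x (v ∘ e)
      (Fin.cast h (Fin.castAdd (q + 1) k))) =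
      (fun k => (v ∘ e) (Fin.cast h' (Fin.castAdd q k))) := by
    ext k
    have : Fin.cast h (Fin.castAdd (q + 1) k) =
        (Fin.cast h (Fin.natAdd p j)).succAbove (Fin.cast h' (Fin.castAdd q k)) := by
      ext; simp only [Fin.succAbove, Fin.lt_def]
      split_ifs <;> simp_all <;> omega
    simp [this]
  rw [h1, h2, AlternatingMap.map_insertNth, smul_comm, smul_comm _ (sign e)]
  congr 1
  rw [TensorProduct.tmul_smul, map_zsmul, smul_smul, ← pow_add, add_assoc, pow_add _ p,
    Even.neg_one_pow (n := (j : ℕ) + j) ⟨_, rfl⟩, mul_one]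
  rfl

/-- An alternating map of degree `p` as a function on lists, zero on lists of length `≠ p`. -/
def onList {p : ℕ} (α : L [⋀^Fin p]→ₗ[A] M₁) (l : List L) : M₁ :=
  if h : p = l.length then α fun i => l.get (i.cast h) else 0

lemma onList_of_length {p : ℕ} (α : L [⋀^Fin p]→ₗ[A] M₁) {l : List L} (h : p = l.length) :
    onList α l = α fun i => l.get (i.cast h) := dif_pos h

lemma onList_of_length_ne {p : ℕ} (α : L [⋀^Fin p]→ₗ[A] M₁) {l : List L} (h : p ≠ l.length) :
    onList α l = 0 := dif_neg h

@[simp] lemma onList_zero_nil (α : L [⋀^Fin 0]→ₗ[A] M₁) : onList α [] = α ![] := by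
  rw [onList_of_length (l := []) _ rfl]; congr 1; ext i; exact i.elim0

@[simp] lemma onList_zero_cons (α : L [⋀^Fin 0]→ₗ[A] M₁) (x : L) (l : List L) :
    onList α (x :: l) = 0 := onList_of_length_ne _ (by simp)

@[simp] lemma onList_succ_nil {p : ℕ} (α : L [⋀^Fin (p + 1)]→ₗ[A] M₁) :
    onList α [] = 0 := onList_of_length_ne _ (by simp)

@[simp] lemma onList_succ_cons {p : ℕ} (α : L [⋀^Fin (p + 1)]→ₗ[A] M₁) (x : L) (l : List L) :
    onList α (x :: l) = onList (α.curryLeft x) l := by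
  by_cases h : p = l.length
  · subst h
    rw [onList_of_length _ (by simp), onList_of_length _ rfl, AlternatingMap.curryLeft_apply_apply]
    congr 1
    ext i
    refine Fin.cases ?_ (fun i => ?_) i <;> simp
  · rw [onList_of_length_ne _ (by simpa using h), onList_of_length_ne _ h]

lemma onList_ofFn {p : ℕ} (α : L [⋀^Fin p]→ₗ[A] M₁) (v : Fin p → L) :
    onList α (List.ofFn v) = α v := by
  rw [onList_of_length _ (by simp)]; congr 1; ext i; simp

lemma onList_injective {p : ℕ} {α β : L [⋀^Fin p]→ₗ[A] M₁} (h : ∀ l, onList α l = onList β l) :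
    α = β := by
  ext v; rw [← onList_ofFn, ← onList_ofFn, h]

lemma onList_add {p : ℕ} (α β : L [⋀^Fin p]→ₗ[A] M₁) (l : List L) :
    onList (α + β) l = onList α l + onList β l := by
  unfold onList; split_ifs <;> simp

lemma onList_sub {p : ℕ} (α β : L [⋀^Fin p]→ₗ[A] M₁) (l : List L) :
    onList (α - β) l = onList α l - onList β l := by
  unfold onList; split_ifs <;> simp

lemma onList_zsmul {p : ℕ} (m : ℤ) (α : L [⋀^Fin p]→ₗ[A] M₁) (l : List L) :
    onList (m • α) l = m • onList α l := by
  unfold onList; split_ifs <;> simp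

/-- The list-dependent sign in `shuffle` becomes the usual sign of the degree, because both sides
vanish on lists of any other length. -/
lemma neg_one_pow_smul_onList {p : ℕ} (α : L [⋀^Fin p]→ₗ[A] M₁) (l : List L) :
    (-1 : ℤ) ^ l.length • onList α l = (-1 : ℤ) ^ p • onList α l := by
  by_cases h : p = l.length
  · subst h; rfl
  · simp [onList_of_length_ne _ h]

lemma onList_domDomCongr {p q : ℕ} (h : p = q) (α : L [⋀^Fin p]→ₗ[A] M₁) (l : List L) :
    onList (α.domDomCongr (finCongr h)) l = onList α l := by
  subst h; rfl

lemma shuffle_onList_of_length_ne {p q : ℕ} (α : L [⋀^Fin p]→ₗ[A] M₁) (β : L [⋀^Fin q]→ₗ[A] M₂)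
    (l : List L) (h : p + q ≠ l.length) : shuffle μ l (onList α) (onList β) = 0 := by
  induction l generalizing p q with
  | nil =>
    rcases p with _ | p
    · rcases q with _ | q
      · simp at h
      · simp [shuffle]
    · simp [shuffle]
  | cons x l ih =>
    have h1 : shuffle μ l (fun m => onList α (x :: m)) (onList β) = 0 := by
      rcases p with _ | p
      · simp [shuffle_zero_left]
      · simp only [onList_succ_cons]
        exact ih _ _ (by simp at h; omega)
    have h2 : shuffle μ l (onList α) (fun m => onList β (x :: m)) = 0 := by
      rcases q with _ | q
      · simp [shuffle_zero_right]
      · simp only [onList_succ_cons]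
        exact ih _ _ (by simp at h; omega)
    simp only [shuffle, neg_one_pow_smul_onList, shuffle_zsmul_left, h1, h2, smul_zero, add_zero]

/-- Both sides satisfy the same recursion in the first entry; the factors `p + 1` and `q + 1` from
the equal slots build up the factorials. -/
lemma factorial_smul_shuffle {p q : ℕ} (α : L [⋀^Fin p]→ₗ[A] M₁) (β : L [⋀^Fin q]→ₗ[A] M₂)
    (l : List L) (h : p + q = l.length) :
    (p.factorial * q.factorial) • shuffle μ l (onList α) (onList β) =
      altSum μ α β h l.get := by
  induction l generalizing p q with
  | nil =>
    obtain ⟨rfl, rfl⟩ : p = 0 ∧ q = 0 := by simpa using h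
    simp only [shuffle, altSum, List.length_nil]
    simp [onList_zero_nil]
    congr <;> exact Subsingleton.elim _ _
  | cons x l ih =>
    have hget : (x :: l).get = Matrix.vecCons x l.get := by
      ext i; refine Fin.cases ?_ (fun i => ?_) i <;> rfl
    have h0 : p + q = l.length + 1 := h
    have := altSum_cons μ α β h0 x l.get
    rw [hget, this]
    simp only [shuffle, neg_one_pow_smul_onList, shuffle_zsmul_left, smul_add]
    congr 1
    · rcases p with _ | p
      · simp [shuffle_zero_left]
      · rw [sum_castAdd_insertNth μ α β h0 (by omega), ← ih, smul_smul, Nat.factorial_succ,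
          mul_assoc]
        simp only [onList_succ_cons]
    · rcases q with _ | q
      · simp [shuffle_zero_right]
      · rw [sum_natAdd_insertNth μ α β h0 (by omega), ← ih,
          smul_comm ((-1 : ℤ) ^ p) (p.factorial * q.factorial), smul_smul, Nat.factorial_succ]
        simp only [onList_succ_cons]
        rw [mul_left_comm, mul_smul]

/-- Both products agree after multiplication by `p! q!`, which is cancelled by torsion-freeness. -/
lemma onList_shuffleMul [IsAddTorsionFree P] {p q : ℕ} (α : L [⋀^Fin p]→ₗ[A] M₁)
    (β : L [⋀^Fin q]→ₗ[A] M₂) (l : List L) :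
    onList (shuffleMul μ α β) l = shuffle μ l (onList α) (onList β) := by
  by_cases h : p + q = l.length
  · have h0 : p.factorial * q.factorial ≠ 0 := by positivity
    refine nsmul_right_injective h0 ?_
    simp only
    rw [factorial_smul_shuffle μ α β l h, onList_of_length _ h, factorial_smul_shuffleMul]
    obtain ⟨n, hn⟩ : ∃ n, n = l.length := ⟨_, rfl⟩
    have key : ∀ (v : Fin n → L) (h : p + q = n), altSum μ α β rfl (fun i => v (Fin.cast h i)) =
        altSum μ α β h v := by
      rintro v rfl; rfl
    subst hn
    exact key _ h
  · rw [shuffle_onList_of_length_ne μ α β l h, onList_of_length_ne _ h]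

end Shuffle

/-! ### Lie derivatives and differentials of functions on lists -/

section ListCalculus

variable {R A L : Type*} [CommRing R] [CommRing A] [Algebra R A]

/-- Multiplication of a function on lists by `(-1)` to the length. -/
def listParity (a : List L → A) (l : List L) : A := (-1 : ℤ) ^ l.length • a l

/-- The Lie derivative of functions on lists with anchor `ρ` and `ad x = b`. -/
def listLie (ρ : Derivation R A A) (b : L → L) : List L → (List L → A) → A
  | [], a => ρ (a [])
  | y :: l, a => listLie ρ b l (fun m => a (y :: m)) - a (b y :: l)

/-- The exterior differential of functions on lists with anchor `ρ` and bracket `B`. -/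
def listD (ρ : L → Derivation R A A) (B : L → L → L) : List L → (List L → A) → A
  | [], _ => 0
  | x :: l, a => listLie (ρ x) (B x) l a - listD ρ B l (fun m => a (x :: m))

lemma listParity_cons (a : List L → A) (x : L) (l : List L) :
    listParity a (x :: l) = -listParity (fun m => a (x :: m)) l := by
  simp [listParity, pow_succ]

lemma listParity_listParity (a : List L → A) : listParity (listParity a) = a := by
  ext l
  rw [listParity, listParity, smul_smul, ← pow_add, Even.neg_one_pow ⟨_, rfl⟩, one_smul]

section Lie

variable (ρ : Derivation R A A) (b : L → L)

lemma listLie_zero (l : List L) : listLie ρ b l (fun _ => 0) = 0 := by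
  induction l with
  | nil => simp [listLie]
  | cons x l ih => simp [listLie, ih]

lemma listLie_add (l : List L) (a a' : List L → A) :
    listLie ρ b l (fun m => a m + a' m) = listLie ρ b l a + listLie ρ b l a' := by
  induction l generalizing a a' with
  | nil => simp [listLie]
  | cons x l ih => simp only [listLie, ih]; abel

lemma listLie_neg (l : List L) (a : List L → A) :
    listLie ρ b l (fun m => -a m) = -listLie ρ b l a := by
  induction l generalizing a with
  | nil => simp [listLie]
  | cons x l ih => simp only [listLie, ih]; abel

lemma listLie_listParity (l : List L) (a : List L → A) :
    listLie ρ b l (listParity a) = listParity (fun m => listLie ρ b m a) l := by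
  induction l generalizing a with
  | nil => simp [listLie, listParity]
  | cons x l ih =>
    simp only [listLie, listParity_cons, listLie_neg, ih]
    simp only [listParity, smul_sub]
    abel

end Lie

lemma shuffle_neg_left (l : List L) (a b : List L → A) :
    shuffle (LinearMap.mul' A A) l (fun m => -a m) b = -shuffle (LinearMap.mul' A A) l a b := by
  simpa using shuffle_zsmul_left (LinearMap.mul' A A) l (-1) a b

lemma shuffle_sub_left (l : List L) (a a' b : List L → A) :
    shuffle (LinearMap.mul' A A) l (fun m => a m - a' m) b =
      shuffle (LinearMap.mul' A A) l a b - shuffle (LinearMap.mul' A A) l a' b := by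
  simp only [sub_eq_add_neg, shuffle_add_left, shuffle_neg_left]

lemma shuffle_sub_right (l : List L) (a b b' : List L → A) :
    shuffle (LinearMap.mul' A A) l a (fun m => b m - b' m) =
      shuffle (LinearMap.mul' A A) l a b - shuffle (LinearMap.mul' A A) l a b' := by
  have h := shuffle_zsmul_right (LinearMap.mul' A A) l (-1) a b'
  simp only [neg_smul, one_smul] at h
  simp only [sub_eq_add_neg, shuffle_add_right, h]

lemma shuffle_cons (x : L) (l : List L) (a b : List L → A) :
    shuffle (LinearMap.mul' A A) (x :: l) a b =
      shuffle (LinearMap.mul' A A) l (fun m => a (x :: m)) b +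
        shuffle (LinearMap.mul' A A) l (listParity a) (fun m => b (x :: m)) := rfl

/-- Induction on the list: on the empty list this is the Leibniz rule of `ρ`. Afterwards contraction
is an antiderivation for the product, and the degree-zero operator `listLie` commutes with its
parity sign. -/
lemma listLie_shuffle (ρ : Derivation R A A) (b : L → L) (l : List L) (f g : List L → A) :
    listLie ρ b l (fun m => shuffle (LinearMap.mul' A A) m f g) =
      shuffle (LinearMap.mul' A A) l (fun m => listLie ρ b m f) g +
        shuffle (LinearMap.mul' A A) l f (fun m => listLie ρ b m g) := by
  induction l generalizing f g with
  | nil => simp [listLie, shuffle]; ring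
  | cons y l ih =>
    have h : listParity (fun m => listLie ρ b m f) = fun m => listLie ρ b m (listParity f) :=
      funext fun m => (listLie_listParity ρ b m f).symm
    simp only [listLie, shuffle_cons, listLie_add, ih, h, shuffle_sub_left, shuffle_sub_right]
    abel

section D

variable (ρ : L → Derivation R A A) (B : L → L → L)

lemma listD_zero (l : List L) : listD ρ B l (fun _ => 0) = 0 := by
  induction l with
  | nil => simp [listD]
  | cons x l ih => simp [listD, ih, listLie_zero]

lemma listD_add (l : List L) (a a' : List L → A) :
    listD ρ B l (fun m => a m + a' m) = listD ρ B l a + listD ρ B l a' := by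
  induction l generalizing a a' with
  | nil => simp [listD]
  | cons x l ih => simp only [listD, ih, listLie_add]; abel

lemma listD_neg (l : List L) (a : List L → A) :
    listD ρ B l (fun m => -a m) = -listD ρ B l a := by
  induction l generalizing a with
  | nil => simp [listD]
  | cons x l ih => simp only [listD, ih, listLie_neg]; abel

lemma listD_listParity (l : List L) (a : List L → A) :
    listD ρ B l (listParity a) = -listParity (fun m => listD ρ B m a) l := by
  induction l generalizing a with
  | nil => simp [listD, listParity]
  | cons x l ih =>
    simp only [listD, listParity_cons, listD_neg, ih, listLie_listParity]
    simp only [listParity, smul_sub]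
    abel

/-- Contracting with the first entry reduces the claim to `listLie_shuffle` and a shorter list. The
mixed terms cancel since `listD` has odd degree and anticommutes with parity. -/
lemma listD_shuffle (l : List L) (f g : List L → A) :
    listD ρ B l (fun m => shuffle (LinearMap.mul' A A) m f g) =
      shuffle (LinearMap.mul' A A) l (fun m => listD ρ B m f) g +
        shuffle (LinearMap.mul' A A) l (listParity f) (fun m => listD ρ B m g) := by
  induction l generalizing f g with
  | nil => simp [listD, shuffle]
  | cons x l ih =>
    have h : listParity (fun m => listD ρ B m f) = fun m => -listD ρ B m (listParity f) :=
      funext fun m => by rw [listD_listParity, neg_neg]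
    simp only [listD, shuffle_cons, listD_add, ih, h, shuffle_sub_left, shuffle_sub_right,
      listLie_shuffle, listParity_cons, shuffle_neg_left, listParity_listParity]
    abel

end D

end ListCalculus

/-! ### Abstract Cartan calculi: Leibniz rule and square zero -/

lemma isAddTorsionFree_of_algebra (R A : Type*) [Field R] [CharZero R] [CommRing A]
    [Algebra R A] : IsAddTorsionFree A := by
  let : Module ℚ A := Module.compHom A (algebraMap ℚ R)
  exact IsAddTorsionFree.of_module_rat A

/-- Forms of positive degree are determined by their contractions; this drives the inductions on the
degree below. -/
lemma curryLeft_injective {A L M : Type*} [CommRing A] [AddCommGroup L] [Module A L]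
    [AddCommGroup M] [Module A M] {p : ℕ} {ω η : L [⋀^Fin (p + 1)]→ₗ[A] M}
    (h : ∀ x, ω.curryLeft x = η.curryLeft x) : ω = η := by
  ext v
  have := DFunLike.congr_fun (h (v 0)) (Matrix.vecTail v)
  simp only [AlternatingMap.curryLeft_apply_apply] at this
  rwa [show Matrix.vecCons (v 0) (Matrix.vecTail v) = v from Matrix.cons_head_tail v] at this

variable {R A L : Type*} [Field R] [CommRing A] [Algebra R A] [AddCommGroup L] [Module A L]

/-- Cartan's relations between a differential `D`, Lie derivatives `lie` and the interior product,
for the anchor `ρ` and the bracket `B`. -/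
structure IsCartanCalculus (D : (p : ℕ) → Form A L p →ₗ[R] Form A L (p + 1))
    (lie : L → (p : ℕ) → Form A L p →ₗ[R] Form A L p) (ρ : L → Derivation R A A)
    (B : L → L → L) : Prop where
  lie_zero : ∀ x (f : Form A L 0), lie x 0 f ![] = ρ x (f ![])
  curryLeft_lie : ∀ x y p (ω : Form A L (p + 1)),
    (lie x (p + 1) ω).curryLeft y = lie x p (ω.curryLeft y) - ω.curryLeft (B x y)
  curryLeft_zero : ∀ x (f : Form A L 0), (D 0 f).curryLeft x = lie x 0 f
  curryLeft_succ : ∀ x p (ω : Form A L (p + 1)),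
    (D (p + 1) ω).curryLeft x = lie x (p + 1) ω - D p (ω.curryLeft x)

namespace IsCartanCalculus

variable {D : (p : ℕ) → Form A L p →ₗ[R] Form A L (p + 1)}
  {lie : L → (p : ℕ) → Form A L p →ₗ[R] Form A L p} {ρ : L → Derivation R A A} {B : L → L → L}

lemma onList_lie (h : IsCartanCalculus D lie ρ B) (x : L) {p : ℕ} (ω : Form A L p) (l : List L) :
    onList (lie x p ω) l = listLie (ρ x) (B x) l (onList ω) := by
  induction l generalizing p with
  | nil =>
    rcases p with _ | p
    · simp [listLie, h.lie_zero]
    · simp [listLie]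
  | cons y l ih =>
    rcases p with _ | p
    · simp [listLie, listLie_zero]
    · simp only [onList_succ_cons, listLie, h.curryLeft_lie, ← ih, onList_sub]

lemma onList_D (h : IsCartanCalculus D lie ρ B) {p : ℕ} (ω : Form A L p) (l : List L) :
    onList (D p ω) l = listD ρ B l (onList ω) := by
  induction l generalizing p with
  | nil => simp [listD]
  | cons y l ih =>
    rcases p with _ | p
    · simp [listD, listD_zero, h.curryLeft_zero, h.onList_lie]
    · simp only [onList_succ_cons, listD, h.curryLeft_succ, ← ih, ← h.onList_lie, onList_sub]

theorem isDerivationOfDegreeOne [CharZero R] {L : Type*} [LieRing L] [LieAlgebra R L] [Module A L]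
    [LieRingModule L A] [LieRinehartRing A L] [LieRinehartAlgebra R A L]
    {D : (p : ℕ) → Form A L p →ₗ[R] Form A L (p + 1)}
    {lie : L → (p : ℕ) → Form A L p →ₗ[R] Form A L p} {ρ : L → Derivation R A A} {B : L → L → L}
    (h : IsCartanCalculus D lie ρ B) : IsDerivationOfDegreeOne D where
  leibniz p q α β := by
    have := isAddTorsionFree_of_algebra R A
    -- `Form.wedge` unfolds to `shuffleMul` for the multiplication of `A`. On lists the transport of
    -- degrees in the Leibniz rule disappears.
    have hw {p q : ℕ} (α : Form A L p) (β : Form A L q) : onList (α.wedge β) =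
        fun l => shuffle (LinearMap.mul' A A) l (onList α) (onList β) :=
      funext fun l => onList_shuffleMul (LinearMap.mul' A A) α β l
    refine onList_injective fun l => ?_
    rw [h.onList_D, hw, listD_shuffle, onList_add, Form.cast, onList_domDomCongr, onList_zsmul,
      hw, hw, ← shuffle_zsmul_left]
    have h1 {p : ℕ} (ω : Form A L p) : (fun m => listD ρ B m (onList ω)) = onList (D p ω) :=
      funext fun m => (h.onList_D ω m).symm
    have h2 : listParity (onList α) = fun m => (-1 : ℤ) ^ p • onList α m :=
      funext fun m => neg_one_pow_smul_onList α m
    rw [h1, h1, h2]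

/-- On functions this is the compatibility of the anchor with brackets. In higher degree,
contraction with `z` leaves the induction hypothesis and the Jacobi identity for `x, y, z`. -/
lemma lie_lie (h : IsCartanCalculus D lie ρ B)
    (hB : ∀ x y z, B x (B y z) = B (B x y) z + B y (B x z))
    (hρ : ∀ x y f, ρ (B x y) f = ρ x (ρ y f) - ρ y (ρ x f)) (x y : L) {p : ℕ} (ω : Form A L p) :
    lie x p (lie y p ω) = lie (B x y) p ω + lie y p (lie x p ω) := by
  induction p with
  | zero =>
    ext v
    obtain rfl : v = ![] := Subsingleton.elim _ _
    simp [h.lie_zero, hρ]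
  | succ p ih =>
    refine curryLeft_injective fun z => ?_
    simp only [h.curryLeft_lie, map_sub, AlternatingMap.curryLeft_add, LinearMap.add_apply]
    rw [ih, hB x y z, map_add]
    abel

lemma lie_D (h : IsCartanCalculus D lie ρ B)
    (hB : ∀ x y z, B x (B y z) = B (B x y) z + B y (B x z))
    (hρ : ∀ x y f, ρ (B x y) f = ρ x (ρ y f) - ρ y (ρ x f)) (x : L) {p : ℕ} (ω : Form A L p) :
    lie x (p + 1) (D p ω) = D p (lie x p ω) := by
  induction p with
  | zero =>
    refine curryLeft_injective fun y => ?_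
    rw [h.curryLeft_lie, h.curryLeft_zero, h.curryLeft_zero, h.curryLeft_zero,
      h.lie_lie hB hρ x y]
    abel
  | succ p ih =>
    refine curryLeft_injective fun y => ?_
    simp only [h.curryLeft_lie, h.curryLeft_succ, map_sub, ih, h.lie_lie hB hρ x y]
    abel

/-- The Cartan relation gives `i_x D D = lie x D - D i_x D = lie x D - D lie x + D D i_x`. The first
two terms cancel, and the last vanishes by induction, or is absent on functions. -/
theorem D_D (h : IsCartanCalculus D lie ρ B)
    (hB : ∀ x y z, B x (B y z) = B (B x y) z + B y (B x z))
    (hρ : ∀ x y f, ρ (B x y) f = ρ x (ρ y f) - ρ y (ρ x f)) {p : ℕ} (ω : Form A L p) :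
    D (p + 1) (D p ω) = 0 := by
  induction p with
  | zero =>
    refine curryLeft_injective fun x => ?_
    rw [h.curryLeft_succ, h.curryLeft_zero, h.lie_D hB hρ, sub_self]
    rfl
  | succ p ih =>
    refine curryLeft_injective fun x => ?_
    rw [h.curryLeft_succ, h.curryLeft_succ, h.lie_D hB hρ, map_sub, ih, sub_zero, sub_self]
    rfl

end IsCartanCalculus

/-! ### Contraction of inserted forms -/

section Insertion

variable {A L : Type*} [CommRing A] [AddCommGroup L] [Module A L]

/-- Polarization of `ω(z, z, v) = 0` at `z = x + y`. -/
lemma map_vecCons_swap {M : Type*} [AddCommGroup M] [Module A M] {p : ℕ}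
    (ω : L [⋀^Fin (p + 2)]→ₗ[A] M) (x y : L) (v : Fin p → L) :
    ω (Matrix.vecCons x (Matrix.vecCons y v)) = -ω (Matrix.vecCons y (Matrix.vecCons x v)) := by
  have h (z : L) : (ω.curryLeft z).curryLeft z v = 0 := by
    rw [AlternatingMap.curryLeft_same]; rfl
  have h1 := h (x + y)
  simp only [map_add, AlternatingMap.curryLeft_add, LinearMap.add_apply, AlternatingMap.add_apply,
    h, zero_add, add_zero] at h1
  exact eq_neg_of_add_eq_zero_right h1

/-- The sign arises because `curryHead` reserves the first slot of `ω`, so `y` enters the second. -/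
lemma curryLeft_curryHead {q : ℕ} (ω : Form A L (q + 2)) (y : L) :
    ω.curryHead.curryLeft y = -Form.curryHead (ω.curryLeft y) := by
  ext v x
  exact map_vecCons_swap ω x y v

lemma onList_curryHead {q : ℕ} (ω : Form A L (q + 1)) (c : L) (l : List L) :
    onList ω.curryHead l c = onList (ω.curryLeft c) l := by
  by_cases h : q = l.length
  · rw [onList_of_length _ h, onList_of_length _ h]; rfl
  · rw [onList_of_length_ne _ h, onList_of_length_ne _ h]; rfl

open TensorProduct in
lemma shuffle_onList_zero_left {M₁ M₂ P : Type*} [AddCommGroup M₁] [Module A M₁]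
    [AddCommGroup M₂] [Module A M₂] [AddCommGroup P] [Module A P] (μ : M₁ ⊗[A] M₂ →ₗ[A] P)
    (α : L [⋀^Fin 0]→ₗ[A] M₁) (b : List L → M₂) (l : List L) :
    shuffle μ l (onList α) b = μ (α ![] ⊗ₜ b l) := by
  induction l generalizing b with
  | nil => simp [shuffle]
  | cons x l ih => simp [shuffle, neg_one_pow_smul_onList, ih, shuffle_zero_left]

/-- The endomorphism `y ↦ K(x, y)`. -/
def VectorForm.ad (K : VectorForm A L 2) (x : L) : L →ₗ[A] L :=
  (AlternatingMap.ofSubsingleton A L L (0 : Fin 1)).symm (K.curryLeft x)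

lemma VectorForm.ad_apply (K : VectorForm A L 2) (x y : L) : K.ad x y = K ![x, y] := by
  change K.curryLeft x (fun _ => y) = _
  rw [AlternatingMap.curryLeft_apply_apply]
  congr 1
  ext i; fin_cases i <;> rfl

variable [IsAddTorsionFree A]

lemma onList_insertion {k q : ℕ} (K : VectorForm A L (k + 1)) (ω : Form A L (q + 1))
    (l : List L) : onList (insertion K (q + 1) ω) l =
      shuffle (contractRight A L) l (onList K) (onList ω.curryHead) :=
  (onList_domDomCongr _ _ l).trans (onList_shuffleMul (contractRight A L) K ω.curryHead l)

/-- The vector `y` enters either `K` or `ω`. In the second case it passes the `k + 1` arguments of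
`K` and the reserved slot of `ω`, which gives `(-1) ^ (k + 2) = (-1) ^ k`. -/
lemma onList_insertion_cons {k q : ℕ} (K : VectorForm A L (k + 1)) (ω : Form A L (q + 1)) (y : L)
    (l : List L) : onList (insertion K (q + 1) ω) (y :: l) =
      shuffle (contractRight A L) l (onList (K.curryLeft y)) (onList ω.curryHead) +
        (-1 : ℤ) ^ k • onList (insertion K q (ω.curryLeft y)) l := by
  rw [onList_insertion]
  simp only [shuffle, neg_one_pow_smul_onList, onList_succ_cons, shuffle_zsmul_left]
  congr 1
  rcases q with _ | q
  -- For a 1-form there is no slot left for `y`, in agreement with insertion being zero on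
  -- functions.
  · have h : onList (insertion K 0 (ω.curryLeft y)) l = 0 := by
      simp [insertion, onList]
    simp [shuffle_zero_right, h]
  · have h : (fun m => onList ω.curryHead (y :: m)) =
        fun m => (-1 : ℤ) • onList (Form.curryHead (ω.curryLeft y)) m := by
      ext1 m
      rw [onList_succ_cons, curryLeft_curryHead, ← onList_zsmul, neg_smul, one_smul]
    rw [h, shuffle_zsmul_right, onList_insertion, smul_smul, pow_succ, mul_assoc]
    simp

variable {L : Type*} [LieRing L] [Module A L]

lemma curryLeft_insertionOne (N : L →ₗ[A] L) {p : ℕ} (ω : Form A L (p + 1)) (y : L) :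
    (insertionOne N (p + 1) ω).curryLeft y =
      insertionOne N p (ω.curryLeft y) + ω.curryLeft (N y) := by
  refine onList_injective fun l => ?_
  rw [← onList_succ_cons, insertionOne]
  refine (onList_insertion_cons _ ω y l).trans ?_
  rw [shuffle_onList_zero_left, onList_add, add_comm, pow_zero, one_smul]
  congr 1
  exact onList_curryHead ω (N y) l

/-- This is the Cartan relation for `ι_K`: the role of the Lie derivative along `x` is played by
insertion of `K(x, ·)`. -/
lemma curryLeft_insertion_succ (K : VectorForm A L 2) {p : ℕ} (ω : Form A L (p + 1)) (x : L) :
    AlternatingMap.curryLeft (insertion (k := 1) K (p + 1) ω) x =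
      insertionOne (K.ad x) (p + 1) ω - insertion (k := 1) K p (ω.curryLeft x) := by
  refine onList_injective fun l => ?_
  rw [← onList_succ_cons]
  refine (onList_insertion_cons (k := 1) K ω x l).trans ?_
  rw [onList_sub, insertionOne, VectorForm.ad, Equiv.apply_symm_apply, sub_eq_add_neg, pow_one,
    neg_smul, one_smul]
  congr 1
  exact (onList_insertion (k := 0) _ ω l).symm

end Insertion

lemma curryLeft_insertion_zero {A L : Type*} [CommRing A] [LieRing L] [Module A L]
    (K : VectorForm A L 2) (f : Form A L 0) (x : L) :
    AlternatingMap.curryLeft (insertion (k := 1) K 0 f) x = insertionOne (K.ad x) 0 f := by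
  ext v; rfl

/-! ### Cartan's formulas for the exterior differential -/

section Differential

variable {R A L : Type*} [Field R] [CommRing A] [Algebra R A]
  [LieRing L] [LieAlgebra R L] [Module A L] [LieRingModule L A]
  [LieRinehartRing A L] [LieRinehartAlgebra R A L]

/-- Expansion of `koszul` with respect to the first argument. -/
lemma koszul_vecCons {A L : Type*} [CommRing A] [LieRing L] [Module A L] [LieRingModule L A]
    {q : ℕ} (ω : Form A L (q + 1)) (x : L) (v : Fin (q + 1) → L) :
    koszul ω (Matrix.vecCons x v) = ⁅x, ω v⁆ -
      (∑ j : Fin (q + 1), (-1 : ℤ) ^ (j : ℕ) • ω (Matrix.vecCons ⁅x, v j⁆ (j.removeNth v))) -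
        koszul (ω.curryLeft x) v := by
  have e0 : Fin.removeNth 0 (Matrix.vecCons x v) = v := by ext i; simp [Fin.removeNth]
  cases q with
  | zero =>
    have e1 : Fin.removeNth 1 (Matrix.vecCons x v) = ![x] := by
      ext i; fin_cases i; rfl
    have e2 (w : Fin 0 → L) : w = ![] := Subsingleton.elim _ _
    simp only [koszul, Fin.sum_univ_succ, Finset.univ_eq_empty, Finset.sum_empty]
    have hI : Finset.Ici (0 : Fin 1) = {0} := rfl
    simp [e0, e1, e2, hI]
    abel
  | succ q =>
    have e1 {n : ℕ} (i : Fin (n + 1)) (y : L) (w : Fin (n + 1) → L) :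
        Fin.removeNth i.succ (Matrix.vecCons y w) = Matrix.vecCons y (i.removeNth w) := by
      ext j; refine Fin.cases ?_ (fun j => ?_) j <;> simp [Fin.removeNth]
    have hI : Finset.Ici (0 : Fin (q + 2)) = Finset.univ := by ext; simp
    simp only [koszul]
    rw [Fin.sum_univ_succ, Fin.sum_univ_succ (n := q + 1) (f := fun i => ∑ j ∈ Finset.Ici i, _)]
    -- The index `0` terms are those where `x` differentiates or is bracketed. In the others `x` is
    -- the first argument of `ω`, or the second behind a bracket; swapping it forward there produces
    -- the expansion for `ω.curryLeft x`.
    simp only [Fin.castSucc_zero, e0, e1, Matrix.cons_val_zero, Matrix.cons_val_succ, hI,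
      Fin.val_zero, pow_zero, one_smul, Fin.castSucc_succ, zero_add, ← Fin.map_succEmb_Ici,
      Finset.sum_map, Fin.coe_succEmb, Fin.val_succ, AlternatingMap.curryLeft_apply_apply,
      map_vecCons_swap ω x]
    simp only [pow_succ, pow_add, mul_neg, mul_one, neg_mul, neg_neg, neg_smul, smul_neg,
      Finset.sum_neg_distrib]
    abel

variable (R) in
/-- The interior product with `x`. -/
def interior (x : L) (p : ℕ) : Form A L (p + 1) →ₗ[R] Form A L p where
  toFun ω := ω.curryLeft x
  map_add' _ _ := rfl
  map_smul' _ _ := rfl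

variable [CharZero R]

variable (R) in
/-- The Lie derivative along `x`, given by Cartan's formula. -/
def lieAlong (x : L) : (p : ℕ) → Form A L p →ₗ[R] Form A L p
  | 0 => interior R x 0 ∘ₗ d R 0
  | p + 1 => interior R x (p + 1) ∘ₗ d R (p + 1) + d R p ∘ₗ interior R x p

lemma lieAlong_zero_apply (x : L) (f : Form A L 0) (v : Fin 0 → L) :
    lieAlong R x 0 f v = ⁅x, f v⁆ := by
  obtain rfl : v = ![] := Subsingleton.elim _ _
  rfl

lemma lieAlong_succ_apply (x : L) {p : ℕ} (ω : Form A L (p + 1)) (v : Fin (p + 1) → L) :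
    lieAlong R x (p + 1) ω v = ⁅x, ω v⁆ -
      ∑ j : Fin (p + 1), (-1 : ℤ) ^ (j : ℕ) • ω (Matrix.vecCons ⁅x, v j⁆ (j.removeNth v)) := by
  change koszul ω (Matrix.vecCons x v) + koszul (ω.curryLeft x) v = _
  rw [koszul_vecCons, sub_add_cancel]

/-- In the explicit formula for the Lie derivative, the summand `j = 0` is the one where `x` is
bracketed with `y`; the others form the Lie derivative of the contraction. -/
lemma curryLeft_lieAlong (x y : L) {p : ℕ} (ω : Form A L (p + 1)) :
    (lieAlong R x (p + 1) ω).curryLeft y =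
      lieAlong R x p (ω.curryLeft y) - ω.curryLeft ⁅x, y⁆ := by
  ext v
  rw [AlternatingMap.curryLeft_apply_apply, lieAlong_succ_apply, AlternatingMap.sub_apply,
    Fin.sum_univ_succ]
  have e0 : Fin.removeNth 0 (Matrix.vecCons y v) = v := by ext i; simp [Fin.removeNth]
  simp only [e0, Fin.val_zero, pow_zero, one_smul, Matrix.cons_val_zero, Matrix.cons_val_succ,
    AlternatingMap.curryLeft_apply_apply]
  cases p with
  | zero => simp [lieAlong_zero_apply]
  | succ p =>
    have e1 (i : Fin (p + 1)) :
        Fin.removeNth i.succ (Matrix.vecCons y v) = Matrix.vecCons y (i.removeNth v) := by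
      ext j; refine Fin.cases ?_ (fun j => ?_) j <;> simp [Fin.removeNth]
    simp only [e1, lieAlong_succ_apply, AlternatingMap.curryLeft_apply_apply,
      map_vecCons_swap ω y, Fin.val_succ, pow_succ, mul_neg, mul_one, neg_smul, smul_neg,
      Finset.sum_neg_distrib]
    abel

theorem isCartanCalculus_d : IsCartanCalculus (d R (A := A) (L := L)) (lieAlong R)
    (fun x => LieRinehartAlgebra.anchor R A L x) (fun x y => ⁅x, y⁆) where
  lie_zero _ _ := rfl
  curryLeft_lie x y _ ω := curryLeft_lieAlong x y ω
  curryLeft_zero _ _ := rfl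
  curryLeft_succ _ _ _ := eq_sub_of_add_eq rfl

end Differential

/-! ### The torsion of an idempotent and the two cohomology operators -/

section Torsion

variable {R A L : Type*} [Field R] [CharZero R] [CommRing A] [Algebra R A]
  [LieRing L] [LieAlgebra R L] [Module A L] [LieRingModule L A]
  [LieRinehartRing A L] [LieRinehartAlgebra R A L]

omit [LieAlgebra R L] [LieRingModule L A] [LieRinehartRing A L] [LieRinehartAlgebra R A L] in
variable (R) in
/-- Insertion of a vector-valued 2-form is a Cartan calculus with zero anchor. -/
theorem isCartanCalculus_insertion (K : VectorForm A L 2) :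
    IsCartanCalculus (fun p => (insertion (k := 1) K p).restrictScalars R)
      (fun x p => (insertionOne (K.ad x) p).restrictScalars R) 0 (fun x y => -K.ad x y) := by
  have := isAddTorsionFree_of_algebra R A
  refine ⟨fun _ _ => rfl, fun x y p ω => ?_, fun x f => curryLeft_insertion_zero K f x,
    fun x p ω => curryLeft_insertion_succ K ω x⟩
  simp only [LinearMap.coe_restrictScalars, map_neg, sub_neg_eq_add]
  exact curryLeft_insertionOne (K.ad x) ω y

variable (R) in
/-- `𝓛_N + ι_K` is a Cartan calculus with anchor `X ↦ NX` and bracket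
`(X, Y) ↦ [NX, Y] + [X, NY] - N[X, Y] - K(X, Y)`. -/
theorem isCartanCalculus_lieDerivative_add_insertion (N : L →ₗ[A] L) (K : VectorForm A L 2) :
    IsCartanCalculus
      (fun p => lieDerivative R N p + (insertion (k := 1) K p).restrictScalars R)
      (fun x p => lieAlong R (N x) p - (lieAlong R x p ∘ₗ (insertionOne N p).restrictScalars R -
        (insertionOne N p).restrictScalars R ∘ₗ lieAlong R x p) +
          (insertionOne (K.ad x) p).restrictScalars R)
      (fun x => LieRinehartAlgebra.anchor R A L (N x))
      (fun x y => ⁅N x, y⁆ + ⁅x, N y⁆ - N ⁅x, y⁆ - K.ad x y) := by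
  have := isAddTorsionFree_of_algebra R A
  have h := isCartanCalculus_d (R := R) (A := A) (L := L)
  have hsub {p : ℕ} (ω η : Form A L (p + 1)) (x : L) :
      AlternatingMap.curryLeft (ω - η) x = ω.curryLeft x - η.curryLeft x := rfl
  have hadd {p : ℕ} (ω η : Form A L (p + 1)) (x : L) :
      AlternatingMap.curryLeft (ω + η) x = ω.curryLeft x + η.curryLeft x := rfl
  refine ⟨fun x f => ?_, fun x y p ω => ?_, fun x f => ?_, fun x p ω => ?_⟩
  -- On functions all insertions vanish and only the Lie derivative along `N x` is left.
  · have h0 (N : L →ₗ[A] L) (f : Form A L 0) : insertionOne N 0 f = 0 := rfl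
    simp [h0, lieAlong_zero_apply]
  · simp only [LinearMap.add_apply, LinearMap.sub_apply, LinearMap.comp_apply,
      LinearMap.coe_restrictScalars, hsub, hadd, curryLeft_lieAlong, curryLeft_insertionOne,
      map_add, map_sub]
    abel
  · simp only [lieDerivative, LinearMap.add_apply, LinearMap.sub_apply, LinearMap.comp_apply,
      LinearMap.coe_restrictScalars, hsub, hadd, curryLeft_insertionOne, h.curryLeft_zero,
      curryLeft_insertion_zero]
    abel
  -- Commuting `i_x` past `ι_N` leaves `i_{Nx}`. With Cartan's formula this turns `i_x 𝓛_N + 𝓛_N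
  -- i_x` into the Lie derivative along `N x` minus `[lieAlong x, ι_N]`.
  · simp only [lieDerivative, LinearMap.add_apply, LinearMap.sub_apply, LinearMap.comp_apply,
      LinearMap.coe_restrictScalars, hsub, hadd, curryLeft_insertionOne, h.curryLeft_succ,
      curryLeft_insertion_succ, map_add, map_sub]
    abel

lemma ad_neg_torsion_apply (N : L →ₗ[A] L) (x y : L) :
    (-torsion N).ad x y = -(⁅N x, N y⁆ - N ⁅N x, y⁆ - N ⁅x, N y⁆ + N (N ⁅x, y⁆)) := by
  rw [VectorForm.ad_apply]; rfl

variable {N : L →ₗ[A] L} (hN : N ∘ₗ N = N) (hinv : IsInvolutive (LinearMap.range N))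

omit [LieRingModule L A] [LieRinehartRing A L] in
include hN in
lemma map_of_mem_range {x : L} (hx : x ∈ LinearMap.range N) : N x = x := by
  obtain ⟨y, rfl⟩ := hx
  exact LinearMap.congr_fun hN y

omit [LieRingModule L A] [LieRinehartRing A L] in
include hN hinv in
lemma map_lie_of_mem_range {x y : L} (hx : x ∈ LinearMap.range N) (hy : y ∈ LinearMap.range N) :
    N ⁅x, y⁆ = ⁅x, y⁆ :=
  map_of_mem_range hN (hinv x hx y hy)

include hinv in
lemma ad_neg_torsion_mem_range (x y : L) : (-torsion N).ad x y ∈ LinearMap.range N := by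
  rw [ad_neg_torsion_apply]
  refine neg_mem (add_mem (sub_mem (sub_mem (hinv _ ⟨_, rfl⟩ _ ⟨_, rfl⟩) ?_) ?_) ?_) <;>
    exact ⟨_, rfl⟩

include hN hinv in
-- With `Ny = y` the four terms cancel in pairs: `[Nx, y]` against `N[Nx, y]` by involutivity, `N[x,
-- y]` against `N²[x, y]` by idempotence.
lemma ad_neg_torsion_of_mem_right (x : L) {y : L} (hy : y ∈ LinearMap.range N) :
    (-torsion N).ad x y = 0 := by
  rw [ad_neg_torsion_apply, map_of_mem_range hN hy, map_lie_of_mem_range hN hinv ⟨x, rfl⟩ hy,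
    map_of_mem_range hN ⟨_, rfl⟩]
  abel

include hN hinv in
lemma ad_neg_torsion_of_mem_left {x : L} (hx : x ∈ LinearMap.range N) (y : L) :
    (-torsion N).ad x y = 0 := by
  rw [ad_neg_torsion_apply, map_of_mem_range hN hx, map_lie_of_mem_range hN hinv hx ⟨y, rfl⟩,
    map_of_mem_range hN ⟨_, rfl⟩]
  abel

variable (R) in
include hN hinv in
theorem isCohomologyOperator_insertion :
    IsCohomologyOperator (R := R)
      (fun p => (insertion (k := 1) (-torsion N) p).restrictScalars R) where
  toIsDerivationOfDegreeOne := (isCartanCalculus_insertion R (-torsion N)).isDerivationOfDegreeOne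
  sq_eq_zero p ω := by
    refine (isCartanCalculus_insertion R (-torsion N)).D_D (fun x y z => ?_) (fun x y f => ?_) ω
    -- Each of the three iterated brackets has an inner bracket in `Im N`, where the torsion
    -- vanishes.
    · have hm (x y : L) := ad_neg_torsion_mem_range hinv x y
      simp only [map_neg]
      rw [ad_neg_torsion_of_mem_right hN hinv x (hm y z),
        ad_neg_torsion_of_mem_right hN hinv y (hm x z),
        ad_neg_torsion_of_mem_left hN hinv (neg_mem (hm x y)) z]
      simp
    · simp

variable (R) in
include hN hinv in
theorem isCohomologyOperator_lieDerivative_add_insertion :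
    IsCohomologyOperator (R := R)
      (fun p => lieDerivative R N p + (insertion (k := 1) (-torsion N) p).restrictScalars R) where
  toIsDerivationOfDegreeOne :=
    (isCartanCalculus_lieDerivative_add_insertion R N (-torsion N)).isDerivationOfDegreeOne
  sq_eq_zero p ω := by
    have hNN (z : L) : N (N z) = N z := map_of_mem_range hN ⟨z, rfl⟩
    have h2 (x y : L) : N ⁅N x, N y⁆ = ⁅N x, N y⁆ :=
      map_lie_of_mem_range hN hinv ⟨x, rfl⟩ ⟨y, rfl⟩
    -- By idempotence the term `N²[x, y]` of the torsion cancels `-N[x, y]`; what remains is split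
    -- into an `Im N` part and a `Ker N` part.
    have hB (x y : L) : ⁅N x, y⁆ + ⁅x, N y⁆ - N ⁅x, y⁆ - (-torsion N).ad x y =
        ⁅N x, N y⁆ + (⁅N x, y⁆ - N ⁅N x, y⁆) + (⁅x, N y⁆ - N ⁅x, N y⁆) := by
      rw [ad_neg_torsion_apply, hNN]; abel
    have hNB (x y : L) :
        N (⁅N x, N y⁆ + (⁅N x, y⁆ - N ⁅N x, y⁆) + (⁅x, N y⁆ - N ⁅x, N y⁆)) = ⁅N x, N y⁆ := by
      simp only [map_add, map_sub, hNN, h2]; abel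
    refine (isCartanCalculus_lieDerivative_add_insertion R N (-torsion N)).D_D
      (fun x y z => ?_) (fun x y f => ?_) ω
    · have h3 (x y z : L) : N ⁅N x, ⁅N y, N z⁆⁆ = ⁅N x, ⁅N y, N z⁆⁆ :=
        map_lie_of_mem_range hN hinv ⟨x, rfl⟩ (hinv _ ⟨y, rfl⟩ _ ⟨z, rfl⟩)
      have h3' (x y z : L) : N ⁅⁅N x, N y⁆, N z⁆ = ⁅⁅N x, N y⁆, N z⁆ :=
        map_lie_of_mem_range hN hinv (hinv _ ⟨x, rfl⟩ _ ⟨y, rfl⟩) ⟨z, rfl⟩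
      simp only [hB]
      simp only [hNB]
      simp only [lie_add, lie_sub, add_lie, sub_lie, map_add, map_sub, h2, h3, h3']
      -- The component in `Im N` is `[Nx, [Ny, Nz]]`. The other is `P` applied to the sum of the
      -- three double brackets in which one of `x, y, z` occurs without `N`, because `P` kills
      -- brackets of elements of `Im N`. Jacobi is applied to each of the four.
      rw [leibniz_lie (N x) (N y) (N z), leibniz_lie (N x) (N y) z, leibniz_lie (N x) y (N z),
        leibniz_lie x (N y) (N z)]
      simp only [map_add]
      abel
    · simp only [hB]
      simp only [hNB]
      exact lie_lie (N x) (N y) f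

end Torsion

end LieRinehart

end

/-- Smooth vector fields over smooth functions form a Lie–Rinehart algebra, over `ℝ` as well as
after complexification, so the algebraic theorems apply to both cases. -/
theorem mainTheorem2 {n : ℕ} {M : Type*} [TopologicalSpace M]
    [ChartedSpace (EuclideanSpace ℝ (Fin n)) M]
    [IsManifold (𝓡 n) ((⊤ : ℕ∞) : WithTop ℕ∞) M] [T2Space M] :
    (∀ N : SmoothVectorField (𝓡 n) M →ₗ[SmoothFunction (𝓡 n) M] SmoothVectorField (𝓡 n) M,
      N ∘ₗ N = N → LieRinehart.IsInvolutive (LinearMap.range N) →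
        LieRinehart.IsCohomologyOperator (R := ℝ) (fun p =>
          LieRinehart.lieDerivative ℝ N p +
            (LieRinehart.insertion (k := 1) (-LieRinehart.torsion N) p).restrictScalars ℝ) ∧
        LieRinehart.IsCohomologyOperator (R := ℝ) (fun p =>
          (LieRinehart.insertion (k := 1) (-LieRinehart.torsion N) p).restrictScalars ℝ)) ∧
    (∀ N : ComplexSmoothVectorField (𝓡 n) M →ₗ[ComplexSmoothFunction (𝓡 n) M]
        ComplexSmoothVectorField (𝓡 n) M,
      N ∘ₗ N = N → LieRinehart.IsInvolutive (LinearMap.range N) →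
        LieRinehart.IsCohomologyOperator (R := ℂ) (fun p =>
          LieRinehart.lieDerivative ℂ N p +
            (LieRinehart.insertion (k := 1) (-LieRinehart.torsion N) p).restrictScalars ℂ) ∧
        LieRinehart.IsCohomologyOperator (R := ℂ) (fun p =>
          (LieRinehart.insertion (k := 1) (-LieRinehart.torsion N) p).restrictScalars ℂ)) := by
  refine ⟨fun N hN hinv => ⟨?_, ?_⟩, fun N hN hinv => ⟨?_, ?_⟩⟩
  · exact LieRinehart.isCohomologyOperator_lieDerivative_add_insertion ℝ hN hinv
  · exact LieRinehart.isCohomologyOperator_insertion ℝ hN hinv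
  · exact LieRinehart.isCohomologyOperator_lieDerivative_add_insertion ℂ hN hinv
  · exact LieRinehart.isCohomologyOperator_insertion ℂ hN hinv
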